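/- Let $M$ be an oriented matroid on a finite linearly ordered set $E$. Let $t(M;x,y)=\sum_{A\subseteq E}(x-1)^{r(E)-r(A)}(y-1)^{|A|-r(A)}=\sum_{a,b}t_{a,b}\,x^a y^b$ be the Tutte polynomial of its underlying matroid. For $A\subseteq E$ let $-_AM$ be the reorientation of $M$ on $A$. Reorientations are identified with the subsets $A$, so there are $2^{|E|}$ of them. For an oriented matroid $N$ on $E$, the set $O(N)$ of active elements, respectively $O^*(N)$ of dual-active elements, is the set of minima of the positive circuits, respectively positive cocircuits, of $N$. The activity of $N$ is $|O(N)|$ and its dual activity is $|O^*(N)|$. The active partition of $N$ consists of the following sets. For each $a\in O(N)$ it contains the union of the positive circuits with minimum $\ge a$ minus the union of those with minimum $>a$. For each $a\in O^*(N)$ it contains the union of the positive cocircuits with minimum $\ge a$ minus the union of those with minimum $>a$. The activity class of $-_AM$ is the set of all reorientations $-_{A\triangle U}M$, where $U$ is a union of parts of the active partition of $-_AM$. An activity class has activity $i$ and dual activity $j$ if all its members do. It is acyclic, or totally cyclic, if all its members are. Say that $-_AM$ is active-fixed if $O(-_AM)\cap A=\emptyset$, and dual-active-fixed if $O^*(-_AM)\cap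 A=\emptyset$. 1. For all $i,j\ge 0$, the number of activity classes of reorientations of $M$ with activity $i$ and dual activity $j$ equals $t_{j,i}$, the coefficient of $x^jy^i$ in $t(M;x,y)$. 2. Each activity class contains exactly one reorientation that is both active-fixed and dual-active-fixed. For all $i,j\ge 0$, the number of such reorientations of $M$ with activity $i$ and dual activity $j$ equals $t_{j,i}$. 3. Each activity class with activity $i$ and dual activity $j$ contains exactly $2^j$ active-fixed reorientations and exactly $2^i$ dual-active-fixed reorientations. 4. The following enumerations hold. - The number of active-fixed and dual-active-fixed reorientations, and the number of all activity classes, both equal $t(M;1,1)$. - The number of acyclic and dual-active-fixed reorientations, and the number of acyclic activity classes, both equal $t(M;1,0)$. Each acyclic activity class contains exactly one dual-active-fixed reorientation. - The number of active-fixed and totally cyclic reorientations, and the number of totally cyclic activity classes, both equal $t(M;0,1)$. Each totally cyclic activity class contains exactly one active-fixed reorientation. - The number of active-fixed reorientations equals $t(M;2,1)$. - The number of dual-active-fixed reorientations equals $t(M;1,2)$. -/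

import Mathlib

/-- An oriented matroid on the finite set `E`, given by its signed circuits.  A signed subset `X`
is coded by its sign function (`X e = 1` on `X⁺`, `X e = -1` on `X⁻`, `X e = 0` off the support). -/
structure OrientedMatroid (α : Type*) where
  E : Finset α
  circuits : Set (α → SignType)
  support_subset : ∀ X ∈ circuits, Function.support X ⊆ (E : Set α)
  zero_notMem : (0 : α → SignType) ∉ circuits
  neg_mem : ∀ X ∈ circuits, -X ∈ circuits
  incomparable : ∀ X ∈ circuits, ∀ Y ∈ circuits,
    Function.support X ⊆ Function.support Y → X = Y ∨ X = -Y
  elimination : ∀ X ∈ circuits, ∀ Y ∈ circuits, X ≠ -Y → ∀ e, X e = 1 → Y e = -1 →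
    ∃ Z ∈ circuits, Z e = 0 ∧ ∀ f,
      (Z f = 1 → X f = 1 ∨ Y f = 1) ∧ (Z f = -1 → X f = -1 ∨ Y f = -1)

namespace OrientedMatroid

variable {α : Type*}

/-- Unsigned circuit elimination, for the supports of the signed circuits. -/
theorem support_elimination (M : OrientedMatroid α) {X Y : α → SignType} (hX : X ∈ M.circuits)
    (hY : Y ∈ M.circuits) (hXY : Function.support X ≠ Function.support Y) {e : α}
    (hXe : X e ≠ 0) (hYe : Y e ≠ 0) :
    ∃ Z ∈ M.circuits, Function.support Z ⊆
      (Function.support X ∪ Function.support Y) \ {e} := by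
  have key : ∀ X' ∈ M.circuits, ∀ Y' ∈ M.circuits, X' e = 1 → Y' e = -1 →
      Function.support X' = Function.support X → Function.support Y' = Function.support Y →
      ∃ Z ∈ M.circuits, Function.support Z ⊆
        (Function.support X ∪ Function.support Y) \ {e} := by
    intro X' hX' Y' hY' h1 h2 hs ht
    have hne : X' ≠ -Y' := by
      rintro rfl
      apply hXY
      rw [← hs, ← ht]
      ext f
      simp
    obtain ⟨Z, hZ, hZe, hZf⟩ := M.elimination X' hX' Y' hY' hne e h1 h2
    refine ⟨Z, hZ, fun f hf => ⟨?_, ?_⟩⟩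
    · rw [← hs, ← ht]
      simp only [Set.mem_union, Function.mem_support] at hf ⊢
      obtain ⟨hp, hn⟩ := hZf f
      rcases hz : Z f with _ | _ | _
      · exact absurd hz hf
      · rcases hn hz with h | h
        · left; rw [h]; decide
        · right; rw [h]; decide
      · rcases hp hz with h | h
        · left; rw [h]; decide
        · right; rw [h]; decide
    · rintro rfl
      exact hf hZe
  have hnegs : ∀ W : α → SignType, Function.support (-W) = Function.support W := by
    intro W; ext f; simp
  have cases3 : ∀ s : SignType, s ≠ 0 → s = 1 ∨ s = -1 := by decide
  rcases cases3 _ hXe with hx | hx <;> rcases cases3 _ hYe with hy | hy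
  · exact key X hX (-Y) (M.neg_mem Y hY) hx (by simp [hy]) rfl (hnegs Y)
  · exact key X hX Y hY hx hy rfl rfl
  · exact key (-X) (M.neg_mem X hX) (-Y) (M.neg_mem Y hY) (by simp [hx]) (by simp [hy])
      (hnegs X) (hnegs Y)
  · exact key (-X) (M.neg_mem X hX) Y hY (by simp [hx]) hy (hnegs X) rfl

/-- Independence in the underlying matroid: no circuit is contained in `I`. -/
def IndepSet (M : OrientedMatroid α) (I : Set α) : Prop :=
  I ⊆ (M.E : Set α) ∧ ∀ X ∈ M.circuits, ¬ Function.support X ⊆ I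

theorem IndepSet.subset {M : OrientedMatroid α} {I J : Set α} (hJ : M.IndepSet J) (h : I ⊆ J) :
    M.IndepSet I :=
  ⟨h.trans hJ.1, fun X hX hs => hJ.2 X hX (hs.trans h)⟩

theorem IndepSet.augment {M : OrientedMatroid α} {I J : Set α} (hI : M.IndepSet I)
    (hJ : M.IndepSet J) (hIJ : I.ncard < J.ncard) :
    ∃ e ∈ J, e ∉ I ∧ M.IndepSet (insert e I) := by
  by_contra hcon
  push Not at hcon
  have fin : ∀ {K : Set α}, M.IndepSet K → K.Finite := fun hK =>
    M.E.finite_toSet.subset hK.1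
  have hex : ∃ n, ∃ K : Set α, M.IndepSet K ∧ K ⊆ I ∪ J ∧ I.ncard < K.ncard ∧
      (I \ K).ncard = n := ⟨_, J, hJ, Set.subset_union_right, hIJ, rfl⟩
  classical
  obtain ⟨K, hK, hKs, hKc, hKn⟩ := Nat.find_spec hex
  have hmin : ∀ L : Set α, M.IndepSet L → L ⊆ I ∪ J → I.ncard < L.ncard →
      (I \ K).ncard ≤ (I \ L).ncard := by
    intro L h1 h2 h3
    rw [hKn]
    exact Nat.find_min' hex ⟨L, h1, h2, h3, rfl⟩
  obtain ⟨g, hgK, hgI⟩ : ∃ g ∈ K, g ∉ I := by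
    by_contra h
    push Not at h
    exact absurd (Set.ncard_le_ncard h (fin hI)) (not_le.2 hKc)
  obtain ⟨e, heI, heK⟩ : ∃ e ∈ I, e ∉ K := by
    by_contra h
    push Not at h
    have hgJ : g ∈ J := (hKs hgK).resolve_left hgI
    exact hcon g hgJ hgI (hK.subset (Set.insert_subset hgK h))
  have hstep : ∀ f ∈ K, f ∉ I → ∃ X ∈ M.circuits,
      Function.support X ⊆ insert e (K \ {f}) ∧ X e ≠ 0 := by
    intro f hfK hfI
    have hsub : insert e (K \ {f}) ⊆ I ∪ J :=
      Set.insert_subset (Or.inl heI) (Set.sdiff_subset.trans hKs)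
    have hcard : (insert e (K \ {f})).ncard = K.ncard := by
      rw [Set.ncard_insert_of_notMem (fun h => heK h.1) ((fin hK).subset Set.sdiff_subset)]
      exact Set.ncard_sdiff_singleton_add_one hfK (fin hK)
    have hdep : ¬ M.IndepSet (insert e (K \ {f})) := by
      intro hind
      have h1 := hmin _ hind hsub (hcard ▸ hKc)
      refine absurd h1 (not_le.2 (Set.ncard_lt_ncard ?_ ((fin hI).subset Set.sdiff_subset)))
      refine ⟨fun x hx => ⟨hx.1, fun hxK => hx.2 (Or.inr ⟨hxK, ?_⟩)⟩, fun h => ?_⟩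
      · rintro rfl
        exact hfI hx.1
      · exact (h ⟨heI, heK⟩).2 (Or.inl rfl)
    have hgr : insert e (K \ {f}) ⊆ (M.E : Set α) :=
      Set.insert_subset (hI.1 heI) (Set.sdiff_subset.trans hK.1)
    have : ∃ X ∈ M.circuits, Function.support X ⊆ insert e (K \ {f}) := by
      by_contra h
      push Not at h
      exact hdep ⟨hgr, h⟩
    obtain ⟨X, hX, hXs⟩ := this
    refine ⟨X, hX, hXs, fun hXe => hK.2 X hX fun x hx => ?_⟩
    rcases hXs hx with rfl | hx'
    · exact absurd hXe hx
    · exact hx'.1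
  obtain ⟨X, hX, hXs, hXe⟩ := hstep g hgK hgI
  obtain ⟨h, hhX, hhK, hhI⟩ : ∃ h, X h ≠ 0 ∧ h ∈ K ∧ h ∉ I := by
    by_contra hno
    push Not at hno
    refine hI.2 X hX fun x hx => ?_
    rcases hXs hx with rfl | hx'
    · exact heI
    · exact hno x hx hx'.1
  obtain ⟨Y, hY, hYs, hYe⟩ := hstep h hhK hhI
  have hne : Function.support X ≠ Function.support Y := by
    intro heq
    have : h ∈ Function.support Y := heq ▸ hhX
    rcases hYs this with rfl | h'
    · exact hhI heI
    · exact h'.2 rfl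
  obtain ⟨Z, hZ, hZs⟩ := M.support_elimination hX hY hne hXe hYe
  refine hK.2 Z hZ fun x hx => ?_
  obtain ⟨h1, h2⟩ := hZs hx
  rcases h1 with h1 | h1
  · rcases hXs h1 with rfl | h'
    · exact absurd rfl h2
    · exact h'.1
  · rcases hYs h1 with rfl | h'
    · exact absurd rfl h2
    · exact h'.1

/-- The underlying matroid of an oriented matroid: its circuits are the supports of the
signed circuits. -/
def toMatroid (M : OrientedMatroid α) : Matroid α :=
  (IndepMatroid.ofFinite (E := (M.E : Set α)) M.E.finite_toSet M.IndepSet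
    ⟨Set.empty_subset _, fun X hX hs => M.zero_notMem
      (by rwa [Function.support_eq_empty_iff.1 (Set.subset_empty_iff.1 hs)] at hX)⟩
    (fun _ _ hJ h => hJ.subset h)
    (fun _ _ hI hJ h => hI.augment hJ h)
    (fun _ hI => hI.1)).matroid

/-- The Tutte polynomial `t(M; x, y) = ∑_{A ⊆ E} (x - 1)^{r(E) - r(A)} (y - 1)^{|A| - r(A)}`
of the underlying matroid, with `x = X 0` and `y = X 1`. -/
noncomputable def tutte (M : OrientedMatroid α) : MvPolynomial (Fin 2) ℤ :=
  ∑ A ∈ M.E.powerset,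
    (MvPolynomial.X 0 - 1) ^ ((M.toMatroid.eRk (M.E : Set α)).toNat
      - (M.toMatroid.eRk (A : Set α)).toNat) *
    (MvPolynomial.X 1 - 1) ^ (A.card - (M.toMatroid.eRk (A : Set α)).toNat)

/-- The value `t(M; x, y)`. -/
noncomputable def tutteEval (M : OrientedMatroid α) (x y : ℤ) : ℤ :=
  MvPolynomial.eval ![x, y] M.tutte

/-- The coefficient `t_{i,j}` of `x^i y^j` in `t(M; x, y)`. -/
noncomputable def tutteCoeff (M : OrientedMatroid α) (i j : ℕ) : ℤ :=
  MvPolynomial.coeff (Finsupp.single 0 i + Finsupp.single 1 j) M.tutte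

/-- Orthogonality of signed sets: a common element of the supports where the signs agree exists
if and only if one where they are opposite exists. -/
def Orthogonal (X Y : α → SignType) : Prop :=
  (∃ e, X e * Y e = 1) ↔ (∃ e, X e * Y e = -1)

/-- The signed cocircuits: the signatures of the cocircuits of the underlying matroid that are
orthogonal to all signed circuits. -/
def cocircuits (M : OrientedMatroid α) : Set (α → SignType) :=
  {Y | M.toMatroid.IsCocircuit (Function.support Y) ∧ ∀ X ∈ M.circuits, Orthogonal X Y}

/-- The supports of the positive circuits (no element has a negative sign). -/
def posCircuits (M : OrientedMatroid α) : Set (Set α) :=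
  {C | ∃ X ∈ M.circuits, (∀ e, 0 ≤ X e) ∧ Function.support X = C}

/-- The supports of the positive cocircuits. -/
def posCocircuits (M : OrientedMatroid α) : Set (Set α) :=
  {D | ∃ Y ∈ M.cocircuits, (∀ e, 0 ≤ Y e) ∧ Function.support Y = D}

def Acyclic (M : OrientedMatroid α) : Prop :=
  M.posCircuits = ∅

def TotallyCyclic (M : OrientedMatroid α) : Prop :=
  ∀ e ∈ M.E, ∃ C ∈ M.posCircuits, e ∈ C

variable [LinearOrder α]

/-- Reversal of the signs of a signed set on `A`. -/
def flip (A : Finset α) (X : α → SignType) : α → SignType :=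
  fun e => if e ∈ A then -X e else X e

theorem flip_flip (A : Finset α) (X : α → SignType) : flip A (flip A X) = X := by
  funext e
  by_cases h : e ∈ A <;> simp [flip, h]

theorem flip_neg (A : Finset α) (X : α → SignType) : flip A (-X) = -flip A X := by
  funext e
  by_cases h : e ∈ A <;> simp [flip, h]

theorem support_flip (A : Finset α) (X : α → SignType) :
    Function.support (flip A X) = Function.support X := by
  ext e
  by_cases h : e ∈ A <;> simp [flip, h]

/-- The reorientation `-_A M`: signs are reversed on `A` in every signed circuit. -/
def reorient (M : OrientedMatroid α) (A : Finset α) : OrientedMatroid α where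
  E := M.E
  circuits := {X | flip A X ∈ M.circuits}
  support_subset X hX := support_flip A X ▸ M.support_subset _ hX
  zero_notMem h := M.zero_notMem (by
    have h0 : flip A (0 : α → SignType) = 0 := by
      funext e
      simp [flip]
    rwa [Set.mem_ofPred_eq, h0] at h)
  neg_mem X hX := by
    rw [Set.mem_ofPred_eq, flip_neg]
    exact M.neg_mem _ hX
  incomparable X hX Y hY h := by
    have inj : ∀ U V : α → SignType, flip A U = flip A V → U = V := fun U V h => by
      rw [← flip_flip A U, h, flip_flip]
    rcases M.incomparable _ hX _ hY (by rwa [support_flip, support_flip]) with h | h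
    · exact Or.inl (inj _ _ h)
    · exact Or.inr (inj _ _ (by rw [h, flip_neg]))
  elimination X hX Y hY hne e hXe hYe := by
    have hne' : flip A X ≠ -flip A Y := fun h => hne (by
      rw [← flip_flip A X, h, ← flip_neg, flip_flip])
    by_cases he : e ∈ A
    · obtain ⟨Z, hZ, hZe, hZf⟩ := M.elimination _ hY _ hX
        (fun h => hne' (by rw [h, neg_neg])) e (by simp [flip, he, hYe]) (by simp [flip, he, hXe])
      refine ⟨flip A Z, by rwa [Set.mem_ofPred_eq, flip_flip], by simp [flip, hZe], fun f => ?_⟩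
      have h := hZf f
      by_cases hf : f ∈ A <;> simp only [flip, hf, if_true, if_false] at h ⊢ <;>
        revert h <;> generalize X f = a <;> generalize Y f = b <;> generalize Z f = c <;>
        revert a b c <;> decide
    · obtain ⟨Z, hZ, hZe, hZf⟩ := M.elimination _ hX _ hY hne' e
        (by simp [flip, he, hXe]) (by simp [flip, he, hYe])
      refine ⟨flip A Z, by rwa [Set.mem_ofPred_eq, flip_flip], by simp [flip, hZe], fun f => ?_⟩
      have h := hZf f
      by_cases hf : f ∈ A <;> simp only [flip, hf, if_true, if_false] at h ⊢ <;>
        revert h <;> generalize X f = a <;> generalize Y f = b <;> generalize Z f = c <;>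
        revert a b c <;> decide

/-- The active elements: the minima of the positive circuits. -/
def activeElements (M : OrientedMatroid α) : Set α :=
  {a | ∃ C ∈ M.posCircuits, IsLeast C a}

/-- The dual-active elements: the minima of the positive cocircuits. -/
def dualActiveElements (M : OrientedMatroid α) : Set α :=
  {a | ∃ D ∈ M.posCocircuits, IsLeast D a}

noncomputable def activity (M : OrientedMatroid α) : ℕ := M.activeElements.ncard

noncomputable def dualActivity (M : OrientedMatroid α) : ℕ := M.dualActiveElements.ncard

/-- For an active element `a`: the part with minimum `a` of the active partition, i.e. the union of
the positive circuits with minimum at least `a`, minus the union of those with minimum greater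
than `a`. -/
def cyclicPart (M : OrientedMatroid α) (a : α) : Set α :=
  ⋃₀ {C | C ∈ M.posCircuits ∧ ∃ m, IsLeast C m ∧ a ≤ m} \
    ⋃₀ {C | C ∈ M.posCircuits ∧ ∃ m, IsLeast C m ∧ a < m}

/-- For a dual-active element `a`: the part with minimum `a` of the active partition. -/
def acyclicPart (M : OrientedMatroid α) (a : α) : Set α :=
  ⋃₀ {D | D ∈ M.posCocircuits ∧ ∃ m, IsLeast D m ∧ a ≤ m} \
    ⋃₀ {D | D ∈ M.posCocircuits ∧ ∃ m, IsLeast D m ∧ a < m}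

/-- The active partition of `M`, as a family of subsets of the ground set. -/
def activePartition (M : OrientedMatroid α) : Set (Set α) :=
  M.cyclicPart '' M.activeElements ∪ M.acyclicPart '' M.dualActiveElements

/-- The activity class of the reorientation `-_A M`: all reorientations obtained from it by
reorienting a union of parts of its active partition.  A reorientation `-_B M` of `M` is
identified with the set `B ⊆ E`. -/
def activityClass (M : OrientedMatroid α) (A : Finset α) : Set (Finset α) :=
  {B | ∃ P ⊆ (M.reorient A).activePartition, (B : Set α) = symmDiff (A : Set α) (⋃₀ P)}

/-- The set of all activity classes of reorientations of `M`. -/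
def activityClasses (M : OrientedMatroid α) : Set (Set (Finset α)) :=
  {K | ∃ A ⊆ M.E, K = M.activityClass A}

/-- All members of the class `K` have activity `i` and dual activity `j`. -/
def ClassHasActivities (M : OrientedMatroid α) (K : Set (Finset α)) (i j : ℕ) : Prop :=
  ∀ A ∈ K, (M.reorient A).activity = i ∧ (M.reorient A).dualActivity = j

/-- `-_A M` is active-fixed with respect to `M`: no active element of `-_A M` is in `A`. -/
def ActiveFixed (M : OrientedMatroid α) (A : Finset α) : Prop :=
  (M.reorient A).activeElements ∩ (A : Set α) = ∅

/-- `-_A M` is dual-active-fixed with respect to `M`. -/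
def DualActiveFixed (M : OrientedMatroid α) (A : Finset α) : Prop :=
  (M.reorient A).dualActiveElements ∩ (A : Set α) = ∅

end OrientedMatroid

/-! Two facts carry everything. First, `tutte_eq_sum`: the Tutte polynomial is the sum of x^(dual
activity) y^(activity) over the reorientations that are both active-fixed and dual-active-fixed.
Second, `bijOn_activityClass`: an activity class is a Boolean cube, coordinatised by the minima of
the parts that a member contains.

The first fact is deletion-contraction of the greatest element w, for minors in which all elements
outside F are contracted (C) or deleted (D). Reorientations are paired by flipping w. Since w is
greatest, it is active only if it is a loop of the minor and dual-active only if it is a coloop. In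
general, one member of a pair has the active and dual-active elements of the deletion, and the other
those of the contraction (`DualPair.hasMin_dichotomy`). If w is a loop or coloop, only the member
not containing w is fixed, and w contributes a factor y or x. This is the Tutte recursion
(`sum_fixedWeight_eq_minorTutte`). The dichotomy rests on orthogonality and on a Minty-type
colouring lemma (`colouring`), which needs every cocircuit of the underlying matroid to carry a
signature orthogonal to all signed circuits (`exists_cocircuit_support_eq`).

For the second fact, each part is built from differences of unions of positive circuits, or
cocircuits, avoiding an initial segment. Flipping such a union changes none of these unions
(`DualPair.posUnion_flip`), so flipping parts preserves the active partition and the activity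
classes are equivalence classes. Parts are disjoint and contain their minima, so the minima
contained in a member can be prescribed freely and determine it. Containing none of them gives the
unique fixed member; containing no active one leaves 2^(dual activity) choices, and dually. Summing
over fixed members gives all the enumerations. -/

namespace OrientedMatroid

/-! ### Signatures of cocircuits, from the signed circuit axioms. -/

section Duality

variable {α : Type*} {M : OrientedMatroid α}

@[simp]
theorem support_neg_sign (X : α → SignType) : Function.support (-X) = Function.support X := by
  ext; simp

theorem toMatroid_isCircuit_iff {C : Set α} :
    M.toMatroid.IsCircuit C ↔ ∃ X ∈ M.circuits, Function.support X = C := by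
  have hindep : ∀ {I : Set α}, M.toMatroid.Indep I ↔ M.IndepSet I := Iff.rfl
  have hdep : ∀ {X}, X ∈ M.circuits → M.toMatroid.Dep (Function.support X) := fun {X} hX =>
    ⟨fun h => (hindep.1 h).2 X hX subset_rfl, M.support_subset X hX⟩
  have hex : ∀ {D : Set α}, M.toMatroid.Dep D → ∃ X ∈ M.circuits, Function.support X ⊆ D := by
    intro D hD
    by_contra! h
    exact hD.1 (hindep.2 ⟨hD.2, h⟩)
  rw [Matroid.isCircuit_iff]
  constructor
  · rintro ⟨hC, hmin⟩
    obtain ⟨X, hX, hXC⟩ := hex hC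
    exact ⟨X, hX, hmin (hdep hX) hXC⟩
  · rintro ⟨X, hX, rfl⟩
    refine ⟨hdep hX, fun D hD hDX => hDX.antisymm ?_⟩
    obtain ⟨Y, hY, hYD⟩ := hex hD
    rcases M.incomparable Y hY X hX (hYD.trans hDX) with rfl | rfl
    · exact hYD
    · simpa using hYD

theorem isCircuit_support {X : α → SignType} (hX : X ∈ M.circuits) :
    M.toMatroid.IsCircuit (Function.support X) :=
  toMatroid_isCircuit_iff.2 ⟨X, hX, rfl⟩

theorem support_union_finite {X Y : α → SignType} (hX : X ∈ M.circuits) (hY : Y ∈ M.circuits) :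
    (Function.support X ∪ Function.support Y).Finite :=
  M.E.finite_toSet.subset (Set.union_subset (M.support_subset X hX) (M.support_subset Y hY))

/-- Signed circuit elimination, stated symmetrically in the two signs. -/
theorem signed_elimination {X Y : α → SignType} (hX : X ∈ M.circuits) (hY : Y ∈ M.circuits)
    (hne : X ≠ -Y) {e : α} (he : X e ≠ 0) (hXY : Y e = -X e) :
    ∃ Z ∈ M.circuits, Z e = 0 ∧ ∀ f, Z f ≠ 0 → Z f = X f ∨ Z f = Y f := by
  have key : ∀ a b c : SignType, ((c = 1 → a = 1 ∨ b = 1) ∧ (c = -1 → a = -1 ∨ b = -1)) →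
      c ≠ 0 → c = a ∨ c = b := by decide
  have cases3 : ∀ s : SignType, s ≠ 0 → s = 1 ∨ s = -1 := by decide
  rcases cases3 _ he with h | h
  · obtain ⟨Z, hZ, hZe, hZf⟩ := M.elimination X hX Y hY hne e h (by rw [hXY, h])
    exact ⟨Z, hZ, hZe, fun f => key _ _ _ (hZf f)⟩
  · obtain ⟨Z, hZ, hZe, hZf⟩ := M.elimination Y hY X hX
      (fun h' => hne (by rw [h', neg_neg])) e (by rw [hXY, h, neg_neg]) h
    exact ⟨Z, hZ, hZe, fun f hf => (key _ _ _ (hZf f) hf).symm⟩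

/-- Strong elimination is borrowed from the underlying matroid, so the signs of `Z` are not
controlled. It serves to shrink supports in the inductions below. -/
theorem exists_mem_circuit_strong {X Y : α → SignType} (hX : X ∈ M.circuits)
    (hY : Y ∈ M.circuits) {e f : α} (heX : X e ≠ 0) (heY : Y e ≠ 0) (hfX : X f ≠ 0)
    (hfY : Y f = 0) :
    ∃ Z ∈ M.circuits, Z e = 0 ∧ Z f ≠ 0 ∧ ∀ x, Z x ≠ 0 → X x ≠ 0 ∨ Y x ≠ 0 := by
  obtain ⟨C, hC, hCc, hf⟩ := (isCircuit_support hX).strong_elimination (isCircuit_support hY)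
    (e := e) (f := f) heX heY hfX (by simpa using hfY)
  obtain ⟨Z, hZ, rfl⟩ := toMatroid_isCircuit_iff.1 hCc
  exact ⟨Z, hZ, by_contra fun h => (hC h).2 rfl, hf, fun x hx => (hC hx).1⟩

theorem eq_zero_imp_of_incomparable {X Y : α → SignType} (hX : X ∈ M.circuits)
    (hY : Y ∈ M.circuits) (h1 : X ≠ Y) (h2 : X ≠ -Y) : ∃ g, X g ≠ 0 ∧ Y g = 0 := by
  by_contra! h
  rcases M.incomparable X hX Y hY h with h | h
  exacts [h1 h, h2 h]

/-- If, within `S`, the elements `e` and `f` lie in the same circuits, then their relative sign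
is the same in all these circuits. -/
theorem sign_mul_eq_of_series {e f : α} {S : Set α}
    (hS : ∀ Z ∈ M.circuits, Function.support Z ⊆ S → (Z e ≠ 0 ↔ Z f ≠ 0))
    {X Y : α → SignType} (hX : X ∈ M.circuits) (hY : Y ∈ M.circuits)
    (hXS : Function.support X ⊆ S) (hYS : Function.support Y ⊆ S) (hXe : X e ≠ 0)
    (hYe : Y e ≠ 0) : X e * X f = Y e * Y f := by
  induction hn : (Function.support X ∪ Function.support Y).ncard using Nat.strong_induction_on
    generalizing X Y with
  | _ n ih =>
  have signs : ∀ a b c d : SignType, a ≠ 0 → b ≠ 0 → c ≠ 0 → d ≠ 0 → a * b ≠ c * d →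
      (c = -a ∧ d = b) ∨ (c = a ∧ d = -b) := by decide
  by_contra hcon
  have hXf := (hS X hX hXS).1 hXe
  have hYf := (hS Y hY hYS).1 hYe
  -- Up to negating `Y`, a counterexample is opposite at `e` and equal at `f`.
  wlog hYX : Y e = -X e ∧ Y f = X f generalizing Y
  · have h := (signs _ _ _ _ hXe hXf hYe hYf hcon).resolve_left hYX
    refine this (Y := -Y) (M.neg_mem Y hY) ?_ ?_ ?_ ?_ ?_ ?_ <;> simp_all
  obtain ⟨hYe', hYf'⟩ := hYX
  have ssub : ∀ {T U : α → SignType} {g : α}, (∀ x, T x ≠ 0 → X x ≠ 0 ∨ Y x ≠ 0) →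
      (∀ x, U x ≠ 0 → X x ≠ 0 ∨ Y x ≠ 0) → T g = 0 → U g = 0 → (X g ≠ 0 ∨ Y g ≠ 0) →
      (Function.support T ∪ Function.support U).ncard < n := by
    intro T U g hT hU hTg hUg hg
    rw [← hn]
    refine Set.ncard_lt_ncard ⟨?_, fun h => ?_⟩ (support_union_finite hX hY)
    · rintro x (hx | hx)
      exacts [hT x hx, hU x hx]
    · rcases h hg with h | h
      exacts [h hTg, h hUg]
  have inS : ∀ {T : α → SignType}, (∀ x, T x ≠ 0 → X x ≠ 0 ∨ Y x ≠ 0) →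
      Function.support T ⊆ S := fun hT x hx => (hT x hx).elim (fun h => hXS h) (fun h => hYS h)
  -- A circuit inside the union that misses `e` contains all of `X \ Y`. Otherwise, eliminating some
  -- `h` of `Z \ X` between `Y` and `Z` while keeping `e` gives `T`; the unions of `T` with `X` and
  -- with `Y` are smaller, and induction through `T` compares `X` with `Y`.
  have uniq : ∀ Z ∈ M.circuits, (∀ x, Z x ≠ 0 → X x ≠ 0 ∨ Y x ≠ 0) → Z e = 0 →
      ∀ g, X g ≠ 0 → Y g = 0 → Z g ≠ 0 := by
    intro Z hZ hZs hZe g hXg hYg hZg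
    obtain ⟨h, hZh, hXh⟩ := eq_zero_imp_of_incomparable hZ hX
      (by rintro rfl; exact hXe hZe) (by rintro rfl; simp_all)
    have hYh := (hZs h hZh).resolve_left (not_not.2 hXh)
    obtain ⟨T, hT, hTh, hTe, hTs⟩ := exists_mem_circuit_strong hY hZ hYh hZh hYe hZe
    have hTs' : ∀ x, T x ≠ 0 → X x ≠ 0 ∨ Y x ≠ 0 := fun x hx =>
      (hTs x hx).elim Or.inr (hZs x)
    have h1 := ih _ (ssub (T := X) (U := T) (fun x => Or.inl) hTs' hXh hTh (Or.inr hYh)) hX hT hXS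
      (inS hTs') hXe hTe rfl
    refine hcon (h1.trans (ih _ (ssub hTs' (fun x => Or.inr) (g := g) ?_ hYg (Or.inl hXg))
      hT hY (inS hTs') hYS hTe hYe rfl))
    by_contra hTg
    rcases hTs g hTg with h | h
    exacts [h hYg, h hZg]
  obtain ⟨Z, hZ, hZe, hZs⟩ := signed_elimination hX hY
    (by rintro h; have := congrFun h f; simp [hYf'] at this; revert this hXf
        generalize X f = s; revert s; decide) hXe hYe'
  have hZs' : ∀ x, Z x ≠ 0 → X x ≠ 0 ∨ Y x ≠ 0 := fun x hx => by
    rcases hZs x hx with h | h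
    · exact Or.inl (h ▸ hx)
    · exact Or.inr (h ▸ hx)
  obtain ⟨g, hXg, hYg⟩ := eq_zero_imp_of_incomparable hX hY
    (by rintro rfl; exact hcon rfl) (by rintro rfl; simp at hcon)
  have hZg := uniq Z hZ hZs' hZe g hXg hYg
  have hZg' : Z g = X g := (hZs g hZg).resolve_right (by rw [hYg]; exact hZg)
  have hZf : Z f = 0 := by
    by_contra h
    exact (hS Z hZ (inS hZs')).2 h hZe
  -- `Z` vanishes at `e` and `f`, so `X'` inherits both signs from `X`. It contains `e` by `uniq`,
  -- and losing `g` makes its union with `Y` smaller.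
  obtain ⟨X', hX', hX'g, hX's⟩ := signed_elimination hX (M.neg_mem Z hZ)
    (by rintro h; rw [neg_neg] at h; exact hXe (h ▸ hZe)) hXg (by simp [hZg'])
  have hX's' : ∀ x, X' x ≠ 0 → X x ≠ 0 ∨ Y x ≠ 0 := fun x hx => by
    rcases hX's x hx with h | h
    · exact Or.inl (h ▸ hx)
    · refine hZs' x fun h0 => hx ?_
      simp [h, h0]
  have hX'e : X' e ≠ 0 := fun h => uniq X' hX' hX's' h g hXg hYg hX'g
  have hX'f := (hS X' hX' (inS hX's')).1 hX'e
  have h1 : X' e = X e := (hX's e hX'e).resolve_right (by simpa [hZe] using hX'e)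
  have h2 : X' f = X f := (hX's f hX'f).resolve_right (by simpa [hZf] using hX'f)
  refine hcon ?_
  rw [← h1, ← h2]
  exact ih _ (ssub hX's' (fun x => Or.inr) hX'g hYg (Or.inl hXg)) hX' hY (inS hX's') hYS hX'e hYe rfl

/-- A set that no circuit meets in exactly one element. -/
def Cocyclic (M : OrientedMatroid α) (D : Set α) : Prop :=
  ∀ X ∈ M.circuits, ∀ e ∈ D, X e ≠ 0 → ∃ f ∈ D, f ≠ e ∧ X f ≠ 0

theorem Cocyclic.sign_mul_eq {D : Set α} (hD : M.Cocyclic D) {e f : α} (hef : e ≠ f)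
    {X Y : α → SignType} (hX : X ∈ M.circuits) (hY : Y ∈ M.circuits)
    (hXD : Function.support X ∩ D = {e, f}) (hYD : Function.support Y ∩ D = {e, f}) :
    X e * X f = Y e * Y f := by
  have heX : e ∈ Function.support X ∩ D := hXD ▸ (by simp)
  have hfX : f ∈ Function.support X ∩ D := hXD ▸ (by simp)
  have heY : e ∈ Function.support Y ∩ D := hYD ▸ (by simp)
  have sub : ∀ {Z : α → SignType}, Function.support Z ∩ D = {e, f} →
      Function.support Z ⊆ Dᶜ ∪ {e, f} := by
    intro Z hZ x hx
    by_cases h : x ∈ D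
    · exact Or.inr (hZ ▸ ⟨hx, h⟩)
    · exact Or.inl h
  refine sign_mul_eq_of_series (S := Dᶜ ∪ {e, f}) ?_ hX hY (sub hXD) (sub hYD) heX.1 heY.1
  intro Z hZ hZS
  constructor
  · intro h
    obtain ⟨g, hg, hge, hZg⟩ := hD Z hZ e heX.2 h
    rcases hZS hZg with h' | rfl | rfl
    exacts [absurd hg h', absurd rfl hge, hZg]
  · intro h
    obtain ⟨g, hg, hge, hZg⟩ := hD Z hZ f hfX.2 h
    rcases hZS hZg with h' | rfl | rfl
    exacts [absurd hg h', hZg, absurd rfl hge]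

/-- Eliminating `f` between `Z` and `±X` disturbs the trace on `D` only at `e`, with a forced sign.
The danger is a result disjoint from `D`; the induction on the union of supports removes it. -/
theorem Cocyclic.exists_elimination {D : Set α} (hD : M.Cocyclic D) {e f : α} (hef : e ≠ f)
    {Z X : α → SignType} (hZ : Z ∈ M.circuits) (hX : X ∈ M.circuits)
    (hXD : Function.support X ∩ D = {e, f}) (hZf : Z f ≠ 0)
    (hZD : Function.support Z ∩ D ≠ {e, f}) :
    ∃ Z' ∈ M.circuits, Z' f = 0 ∧ (∃ x ∈ D, Z' x ≠ 0) ∧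
      ∀ x ∈ D, Z' x ≠ 0 → Z' x = Z x ∨ (x = e ∧ Z' x = -(Z f * X f * X e)) := by
  induction hn : (Function.support Z ∪ Function.support X).ncard using Nat.strong_induction_on
    generalizing X with
  | _ n ih =>
  have heX : e ∈ Function.support X ∩ D := hXD ▸ (by simp)
  have hfX : f ∈ Function.support X ∩ D := hXD ▸ (by simp)
  have signs : ∀ a b : SignType, a ≠ 0 → b ≠ 0 → a = b ∨ a = -b := by decide
  wlog hs : X f = -Z f generalizing X
  · have hs' := (signs _ _ hfX.1 hZf).resolve_right hs
    have := this (X := -X) (M.neg_mem X hX) (by simpa using hXD) (by simpa using hn)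
      (by simpa using heX) (by simpa using hfX) (by simp [hs'])
    simpa using this
  have hXZ : Z ≠ -X := by
    rintro rfl
    exact hZD (by simpa using hXD)
  obtain ⟨Z', hZ', hZ'f, hZ's⟩ := signed_elimination hZ hX hXZ hZf hs
  have hxD : ∀ x ∈ D, x ≠ e → x ≠ f → X x = 0 := by
    intro x hx hxe hxf
    by_contra h
    have : x ∈ Function.support X ∩ D := ⟨h, hx⟩
    rw [hXD] at this
    rcases this with rfl | rfl
    exacts [hxe rfl, hxf rfl]
  by_cases hne : ∃ x ∈ D, Z' x ≠ 0
  · refine ⟨Z', hZ', hZ'f, hne, fun x hx hZ'x => ?_⟩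
    rcases hZ's x hZ'x with h | h
    · exact Or.inl h
    · right
      have hxe : x = e := by
        by_contra hxe
        rcases eq_or_ne x f with rfl | hxf
        · exact hZ'x hZ'f
        · exact hZ'x (h.trans (hxD x hx hxe hxf))
      refine ⟨hxe, h.trans ?_⟩
      rw [hxe, hs]
      revert hZf
      generalize Z f = a
      generalize X e = b
      revert a b
      decide
  · push Not at hne
    obtain ⟨g, hZ'g, hZg⟩ := eq_zero_imp_of_incomparable hZ' hZ
      (by rintro rfl; exact hZf hZ'f) (by rintro rfl; simp at hZ'f; exact hZf hZ'f)
    have hXg : X g ≠ 0 := by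
      rcases hZ's g hZ'g with h | h
      · exact absurd (h.trans hZg) hZ'g
      · exact h ▸ hZ'g
    -- As `Z'` misses `D`, using it to remove `g` from `X` keeps the trace `{e, f}`. By
    -- `sign_mul_eq` the relative sign is also kept, while the union with `Z` loses `g`.
    obtain ⟨T, hT, hTg, hTe, hTs⟩ := exists_mem_circuit_strong hX hZ' hXg hZ'g heX.1
      (hne e heX.2)
    have hTD : ∀ x ∈ D, T x ≠ 0 → x = e ∨ x = f := by
      intro x hx hTx
      have : X x ≠ 0 := (hTs x hTx).resolve_right (not_not.2 (hne x hx))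
      have : x ∈ Function.support X ∩ D := ⟨this, hx⟩
      rwa [hXD] at this
    have hTf : T f ≠ 0 := by
      obtain ⟨x, hx, hxe, hTx⟩ := hD T hT e heX.2 hTe
      rcases hTD x hx hTx with rfl | rfl
      exacts [absurd rfl hxe, hTx]
    have hTD' : Function.support T ∩ D = {e, f} := by
      ext x
      constructor
      · rintro ⟨h1, h2⟩
        exact hTD x h2 h1
      · rintro (rfl | rfl)
        exacts [⟨hTe, heX.2⟩, ⟨hTf, hfX.2⟩]
    have hlt : (Function.support Z ∪ Function.support T).ncard < n := by
      rw [← hn]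
      refine Set.ncard_lt_ncard ⟨?_, fun h => ?_⟩ (support_union_finite hZ hX)
      · rintro x (hx | hx)
        · exact Or.inl hx
        · rcases hTs x hx with h | h
          · exact Or.inr h
          · rcases hZ's x h with h' | h'
            · exact Or.inl (show Z x ≠ 0 from h' ▸ h)
            · exact Or.inr (show X x ≠ 0 from h' ▸ h)
      · rcases h (Or.inr hXg) with h | h
        exacts [h hZg, h hTg]
    obtain ⟨W, hW, hWf, hWD, hWs⟩ := ih _ hlt hT hTD' rfl
    refine ⟨W, hW, hWf, hWD, fun x hx hWx => (hWs x hx hWx).imp id fun h => ⟨h.1, ?_⟩⟩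
    rw [h.2, mul_assoc, mul_assoc, mul_comm (T f), mul_comm (X f),
      hD.sign_mul_eq hef hT hX hTD' hXD]

/-- A cocyclic set, each two elements of which are the trace of a circuit, carries a signature
that is orthogonal to all circuits. -/
theorem Cocyclic.exists_signature {D : Set α} (hD : M.Cocyclic D) (hne : D.Nonempty)
    (hpair : ∀ e ∈ D, ∀ f ∈ D, e ≠ f → ∃ X ∈ M.circuits, Function.support X ∩ D = {e, f}) :
    ∃ Y : α → SignType, Function.support Y = D ∧ ∀ X ∈ M.circuits, Orthogonal X Y := by
  classical
  obtain ⟨e, he⟩ := hne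
  choose! C hC hCD using hpair e he
  -- The only candidate with `Y e = 1`: orthogonality to `C f`, whose trace on `D` is `{e, f}`,
  -- forces the value at `f`.
  let Y : α → SignType := fun f => if f ∈ D then (if f = e then 1 else -(C f e * C f f)) else 0
  have hCe : ∀ f ∈ D, e ≠ f → C f e ≠ 0 ∧ C f f ≠ 0 := fun f hf hef =>
    ⟨((hCD f hf hef).symm ▸ (by simp) : e ∈ Function.support (C f) ∩ D).1,
      ((hCD f hf hef).symm ▸ (by simp) : f ∈ Function.support (C f) ∩ D).1⟩
  have hYD : ∀ f ∈ D, Y f ≠ 0 := by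
    intro f hf
    rcases eq_or_ne e f with rfl | hef
    · simp [Y, hf]
    · have := hCe f hf hef
      simp [Y, hf, hef.symm, this]
  have hYs : Function.support Y = D := by
    ext f
    by_cases hf : f ∈ D
    · simp [hf, hYD f hf]
    · simp [Y, hf]
  refine ⟨Y, hYs, ?_⟩
  have hYe : Y e = 1 := by simp [Y, he]
  have hYf : ∀ f ∈ D, e ≠ f → Y f = -(C f e * C f f) := fun f hf hef => by
    simp [Y, hf, hef.symm]
  -- A negative product is enough, since applying this to `-Z` gives a positive one. If `Z` had
  -- none, eliminating `f` against `C f` would leave none while shrinking the trace outside `e`.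
  have main : ∀ n, ∀ Z ∈ M.circuits, (Function.support Z ∩ (D \ {e})).ncard = n →
      (∃ x ∈ D, Z x ≠ 0) → ∃ x ∈ D, Z x * Y x = -1 := by
    intro n
    induction n using Nat.strong_induction_on with
    | _ n ih =>
    intro Z hZ hn ⟨x, hx, hZx⟩
    by_contra! hcon
    obtain ⟨f, hf, hef, hZf⟩ : ∃ f ∈ D, e ≠ f ∧ Z f ≠ 0 := by
      obtain ⟨y, hy, hyx, hZy⟩ := hD Z hZ x hx hZx
      rcases eq_or_ne e x with rfl | h
      exacts [⟨y, hy, hyx.symm, hZy⟩, ⟨x, hx, h, hZx⟩]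
    have hZYf := hcon f hf
    have h3 := hYf f hf hef
    obtain ⟨h1, h2⟩ := hCe f hf hef
    by_cases hZD : Function.support Z ∩ D = {e, f}
    · have h4 := hD.sign_mul_eq hef hZ (hC f hf hef) hZD (hCD f hf hef)
      have h5 := hcon e he
      have hZe : Z e ≠ 0 := (hZD.symm ▸ (by simp) : e ∈ Function.support Z ∩ D).1
      rw [hYe] at h5
      rw [h3, ← h4] at hZYf
      revert hZYf h5 hZe hZf
      generalize Z e = a
      generalize Z f = b
      revert a b
      decide
    · obtain ⟨Z', hZ', hZ'f, hZ'D, hZ's⟩ := hD.exists_elimination hef hZ (hC f hf hef)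
        (hCD f hf hef) hZf hZD
      have hlt : (Function.support Z' ∩ (D \ {e})).ncard < n := by
        rw [← hn]
        refine Set.ncard_lt_ncard ⟨?_, fun h => ?_⟩
          ((M.E.finite_toSet.subset (M.support_subset Z hZ)).subset Set.inter_subset_left)
        · rintro y ⟨hy, hyD, hye⟩
          rcases hZ's y hyD hy with h | h
          · exact ⟨show Z y ≠ 0 from h ▸ hy, hyD, hye⟩
          · exact absurd h.1 hye
        · exact (h ⟨hZf, hf, hef.symm⟩).1 hZ'f
      obtain ⟨y, hy, hZ'y⟩ := ih _ hlt Z' hZ' rfl hZ'D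
      have hZ'y0 : Z' y ≠ 0 := by
        intro h
        rw [h] at hZ'y
        simp at hZ'y
      rcases hZ's y hy hZ'y0 with h | ⟨rfl, h⟩
      · exact hcon y hy (h ▸ hZ'y)
      · rw [hYe, h] at hZ'y
        rw [h3] at hZYf
        revert hZ'y hZYf hZf h1 h2
        generalize Z f = a
        generalize C f f = b
        generalize C f y = c
        revert a b c
        decide
  have main' : ∀ Z ∈ M.circuits, (∃ x ∈ D, Z x ≠ 0) → ∃ x, Z x * Y x = -1 := fun Z hZ h =>
    (main _ Z hZ rfl h).imp fun x hx => hx.2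
  have hmul : ∀ a b : SignType, a * b ≠ 0 → a ≠ 0 ∧ b ≠ 0 := by decide
  have hmem : ∀ (Z : α → SignType) x, Z x * Y x ≠ 0 → ∃ x ∈ D, Z x ≠ 0 := fun Z x h =>
    ⟨x, hYs ▸ (hmul _ _ h).2, (hmul _ _ h).1⟩
  intro Z hZ
  constructor
  · rintro ⟨x, hx⟩
    exact main' Z hZ (hmem Z x (by rw [hx]; decide))
  · rintro ⟨x, hx⟩
    obtain ⟨y, hy, hZy⟩ := hmem Z x (by rw [hx]; decide)
    obtain ⟨w, hw⟩ := main' (-Z) (M.neg_mem Z hZ) ⟨y, hy, by simpa using hZy⟩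
    exact ⟨w, by simpa using hw⟩

theorem cocyclic_of_isCocircuit {D : Set α} (hD : M.toMatroid.IsCocircuit D) :
    M.Cocyclic D := by
  intro X hX e he hXe
  by_contra! h
  refine (isCircuit_support hX).inter_isCocircuit_ne_singleton hD (e := e) ?_
  ext x
  constructor
  · rintro ⟨h1, h2⟩
    by_contra hx
    exact h1 (h x h2 hx)
  · rintro rfl
    exact ⟨hXe, he⟩

/-- The complement of a cocircuit becomes spanning once `e` is added, so `f` closes a circuit there.
That circuit cannot meet `D` in `f` alone. -/
theorem exists_circuit_inter_eq_pair {D : Set α} (hD : M.toMatroid.IsCocircuit D) {e f : α}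
    (he : e ∈ D) (hf : f ∈ D) (hef : e ≠ f) :
    ∃ X ∈ M.circuits, Function.support X ∩ D = {e, f} := by
  have hmin := (Matroid.isCocircuit_iff_minimal_compl_nonspanning.1 hD)
  have hsp : M.toMatroid.Spanning (M.toMatroid.E \ (D \ {e})) := by
    by_contra h
    exact (hmin.le_of_le h Set.sdiff_subset he).2 rfl
  have hfcl : f ∈ M.toMatroid.closure (M.toMatroid.E \ (D \ {e})) := by
    rw [hsp.closure_eq]
    exact hD.subset_ground hf
  obtain ⟨C, hCs, hC, hfC⟩ := Matroid.exists_isCircuit_of_mem_closure hfcl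
    (fun h => h.2 ⟨hf, hef.symm⟩)
  obtain ⟨X, hX, rfl⟩ := toMatroid_isCircuit_iff.1 hC
  have hsub : ∀ x ∈ D, X x ≠ 0 → x = e ∨ x = f := by
    intro x hx hXx
    rcases hCs hXx with rfl | h
    · exact Or.inr rfl
    · left
      by_contra hxe
      exact h.2 ⟨hx, hxe⟩
  refine ⟨X, hX, ?_⟩
  obtain ⟨g, hg, hgf, hXg⟩ := cocyclic_of_isCocircuit hD X hX f hf hfC
  obtain rfl := (hsub g hg hXg).resolve_right hgf
  ext x
  constructor
  · rintro ⟨h1, h2⟩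
    exact hsub x h2 h1
  · rintro (rfl | rfl)
    exacts [⟨hXg, hg⟩, ⟨hfC, hf⟩]

/-- Every cocircuit of the underlying matroid is the support of a signed cocircuit. -/
theorem exists_cocircuit_support_eq {D : Set α} (hD : M.toMatroid.IsCocircuit D) :
    ∃ Y ∈ M.cocircuits, Function.support Y = D := by
  obtain ⟨Y, hY, hYo⟩ := (cocyclic_of_isCocircuit hD).exists_signature hD.nonempty
    fun e he f hf hef => exists_circuit_inter_eq_pair hD he hf hef
  exact ⟨Y, ⟨hY ▸ hD, hYo⟩, hY⟩

theorem neg_mem_cocircuits {Y : α → SignType} (hY : Y ∈ M.cocircuits) : -Y ∈ M.cocircuits := by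
  refine ⟨by simpa using hY.1, fun X hX => ?_⟩
  have := hY.2 (-X) (M.neg_mem X hX)
  simpa [Orthogonal] using this

/-- This is the fundamental cocircuit of `e` for a base extending `e` and a basis of `S`. -/
theorem exists_isCocircuit_of_notMem_closure {S : Set α} {e : α} (he : e ∈ M.E)
    (hcl : e ∉ M.toMatroid.closure S) :
    ∃ D, M.toMatroid.IsCocircuit D ∧ e ∈ D ∧ Disjoint D S := by
  obtain ⟨I, hI⟩ := M.toMatroid.exists_isBasis' S
  rw [← hI.closure_eq_closure] at hcl
  have hins : M.toMatroid.Indep (insert e I) :=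
    (hI.indep.notMem_closure_iff (show e ∈ M.toMatroid.E from he)).1 hcl |>.1
  obtain ⟨B, hB, hIB⟩ := hins.exists_isBase_superset
  have heB : e ∈ B := hIB (Set.mem_insert _ _)
  have heI : e ∉ I := fun h =>
    hcl (M.toMatroid.mem_closure_of_mem h hI.indep.subset_ground)
  have hIB' : I ⊆ B \ {e} := fun x hx =>
    ⟨hIB (Set.mem_insert_of_mem _ hx), by rintro rfl; exact heI hx⟩
  refine ⟨_, hB.compl_closure_sdiff_singleton_isCocircuit heB, ⟨he, ?_⟩, ?_⟩
  · exact hB.indep.notMem_closure_sdiff_of_mem heB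
  · rw [Set.disjoint_left]
    rintro x ⟨hxE, hx⟩ hxS
    refine hx (M.toMatroid.closure_subset_closure hIB' ?_)
    rw [hI.closure_eq_closure]
    exact M.toMatroid.mem_closure_of_mem' hxS hxE

end Duality
end OrientedMatroid

namespace OrientedMatroid

/-! ### Orthogonal pairs and the colouring lemma. -/

section Pairs

variable {α : Type*}

/-- Two families of sign vectors that are orthogonal to each other and satisfy the colouring
property: for every colouring with an element `e` outside `R` and `G`, one of them has a vector
that is positive at `e`, vanishes on `R` and is nonnegative off `G`, or the other one has a vector
that is positive at `e`, vanishes on `G` and is nonnegative off `R`. -/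
structure DualPair (E : Finset α) (V W : Set (α → SignType)) : Prop where
  orthogonal : ∀ X ∈ V, ∀ Y ∈ W, Orthogonal X Y
  neg_left : ∀ X ∈ V, -X ∈ V
  neg_right : ∀ Y ∈ W, -Y ∈ W
  colouring : ∀ e ∈ E, ∀ R G : Set α, e ∉ R → e ∉ G → Disjoint R G →
    (∃ X ∈ V, X e = 1 ∧ (∀ x ∈ R, X x = 0) ∧ ∀ x ∉ G, 0 ≤ X x) ∨
    (∃ Y ∈ W, Y e = 1 ∧ (∀ x ∈ G, Y x = 0) ∧ ∀ x ∉ R, 0 ≤ Y x)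

theorem Orthogonal.symm {X Y : α → SignType} (h : Orthogonal X Y) : Orthogonal Y X := by
  unfold Orthogonal at *
  simpa only [mul_comm] using h

theorem DualPair.symm {E : Finset α} {V W : Set (α → SignType)} (h : DualPair E V W) :
    DualPair E W V where
  orthogonal X hX Y hY := (h.orthogonal Y hY X hX).symm
  neg_left := h.neg_right
  neg_right := h.neg_left
  colouring e he R G hR hG hRG := (h.colouring e he G R hG hR hRG.symm).symm

theorem Orthogonal.exists_neg {X Y : α → SignType} (h : Orthogonal X Y) {e : α}
    (he : X e * Y e = 1) : ∃ f, X f * Y f = -1 := h.1 ⟨e, he⟩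

theorem Orthogonal.exists_pos {X Y : α → SignType} (h : Orthogonal X Y) {e : α}
    (he : X e * Y e = -1) : ∃ f, X f * Y f = 1 := h.2 ⟨e, he⟩

/-- Supports meeting only at `e` would give a single nonzero product, hence only one of the two
signs. -/
theorem Orthogonal.eq_zero_of_unique {X Y : α → SignType} (h : Orthogonal X Y) {e : α}
    (hXe : X e ≠ 0) (hXY : ∀ x, x ≠ e → X x = 0 ∨ Y x = 0) : Y e = 0 := by
  by_contra hYe
  have h0 : ∀ x, X x * Y x ≠ 0 → x = e := fun x hx => by
    by_contra hxe
    rcases hXY x hxe with h | h <;> simp [h] at hx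
  have sg : ∀ a b : SignType, a ≠ 0 → b ≠ 0 → a * b = 1 ∨ a * b = -1 := by decide
  rcases sg _ _ hXe hYe with h' | h'
  · obtain ⟨x, hx⟩ := h.exists_neg h'
    obtain rfl := h0 x (by rw [hx]; decide)
    rw [h'] at hx
    revert hx
    decide
  · obtain ⟨x, hx⟩ := h.exists_pos h'
    obtain rfl := h0 x (by rw [hx]; decide)
    rw [h'] at hx
    revert hx
    decide

theorem exists_sign_eq_one {V : Set (α → SignType)} (hV : ∀ X ∈ V, -X ∈ V) {X : α → SignType}
    (hX : X ∈ V) {e : α} (he : X e ≠ 0) :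
    ∃ Y ∈ V, Y e = 1 ∧ ∀ x, Y x = 0 ↔ X x = 0 := by
  have sg : ∀ a : SignType, a ≠ 0 → a = 1 ∨ a = -1 := by decide
  rcases sg _ he with h | h
  · exact ⟨X, hX, h, fun _ => Iff.rfl⟩
  · exact ⟨-X, hV X hX, by simp [h], by simp⟩

variable (M : OrientedMatroid α)

/-- Induction on the uncoloured elements other than `e`: colour one of them, `f`, both ways. With
none left, the question is whether `e` lies in the closure of `G`, and a circuit or a cocircuit
avoiding `G` answers it. -/
theorem colouring (e : α) (he : e ∈ M.E) (R G : Set α) (hR : e ∉ R) (hG : e ∉ G)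
    (hRG : Disjoint R G) :
    (∃ X ∈ M.circuits, X e = 1 ∧ (∀ x ∈ R, X x = 0) ∧ ∀ x ∉ G, 0 ≤ X x) ∨
    (∃ Y ∈ M.cocircuits, Y e = 1 ∧ (∀ x ∈ G, Y x = 0) ∧ ∀ x ∉ R, 0 ≤ Y x) := by
  have sign_or : ∀ s : SignType, s ≠ 0 → s = 1 ∨ s = -1 := by decide
  have sign_nonneg : ∀ s : SignType, 0 ≤ s ∨ s = -1 := by decide
  induction hn : {x | x ∈ M.E ∧ x ∉ R ∧ x ∉ G ∧ x ≠ e}.ncard using Nat.strong_induction_on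
    generalizing R G with
  | _ n ih =>
  have hfin : {x | x ∈ M.E ∧ x ∉ R ∧ x ∉ G ∧ x ≠ e}.Finite :=
    M.E.finite_toSet.subset fun x hx => hx.1
  by_cases hB : ∃ f ∈ M.E, f ∉ R ∧ f ∉ G ∧ f ≠ e
  · obtain ⟨f, hf, hfR, hfG, hfe⟩ := hB
    have h1 := ih _ (by
      rw [← hn]
      refine Set.ncard_lt_ncard ⟨fun x hx => ⟨hx.1, hx.2.1, fun h => hx.2.2.1 (Or.inr h),
        hx.2.2.2⟩, fun h => ?_⟩ hfin
      exact (h ⟨hf, hfR, hfG, hfe⟩).2.2.1 (Set.mem_insert _ _)) R (insert f G) hR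
      (by rintro (rfl | h); exacts [hfe rfl, hG h])
      (by rw [Set.disjoint_insert_right]; exact ⟨hfR, hRG⟩) rfl
    have h2 := ih _ (by
      rw [← hn]
      refine Set.ncard_lt_ncard ⟨fun x hx => ⟨hx.1, fun h => hx.2.1 (Or.inr h), hx.2.2.1,
        hx.2.2.2⟩, fun h => ?_⟩ hfin
      exact (h ⟨hf, hfR, hfG, hfe⟩).2.1 (Set.mem_insert _ _)) (insert f R) G
      (by rintro (rfl | h); exacts [hfe rfl, hR h]) hG
      (by rw [Set.disjoint_insert_left]; exact ⟨hfG, hRG⟩) rfl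
    rcases h1 with ⟨X, hX, hXe, hXR, hXG⟩ | ⟨Y, hY, hYe, hYG, hYR⟩
    swap
    · exact Or.inr ⟨Y, hY, hYe, fun x hx => hYG x (Or.inr hx), hYR⟩
    rcases h2 with ⟨X', hX', hX'e, hX'R, hX'G⟩ | ⟨Y, hY, hYe, hYG, hYR⟩
    · exact Or.inl ⟨X', hX', hX'e, fun x hx => hX'R x (Or.inr hx), hX'G⟩
    rcases sign_nonneg (X f) with hXf | hXf
    · refine Or.inl ⟨X, hX, hXe, hXR, fun x hx => ?_⟩
      rcases eq_or_ne x f with rfl | hxf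
      · exact hXf
      · exact hXG x (by simp [hxf, hx])
    rcases sign_nonneg (Y f) with hYf | hYf
    · refine Or.inr ⟨Y, hY, hYe, hYG, fun x hx => ?_⟩
      rcases eq_or_ne x f with rfl | hxf
      · exact hYf
      · exact hYR x (by simp [hxf, hx])
    -- If neither vector serves, both are negative at `f`. Their product there is positive and no
    -- product is negative, against orthogonality.
    obtain ⟨x, hx⟩ := (hY.2 X hX).exists_neg (e := f) (by rw [hXf, hYf]; decide)
    exfalso
    have hxf : x ≠ f := by
      rintro rfl
      rw [hXf, hYf] at hx
      revert hx
      decide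
    by_cases hxR : x ∈ R
    · simp [hXR x hxR] at hx
    by_cases hxG : x ∈ G
    · simp [hYG x hxG] at hx
    have h3 := hXG x (by simp [hxf, hxG])
    have h4 := hYR x (by simp [hxf, hxR])
    revert h3 h4 hx
    generalize X x = a
    generalize Y x = b
    revert a b
    decide
  · push Not at hB
    by_cases hcl : e ∈ M.toMatroid.closure G
    · left
      obtain ⟨C, hCs, hC, heC⟩ := Matroid.exists_isCircuit_of_mem_closure hcl hG
      obtain ⟨X, hX, rfl⟩ := toMatroid_isCircuit_iff.1 hC
      wlog hXe : X e = 1 generalizing X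
      · exact this (-X) (M.neg_mem X hX) (by simpa using hCs) (by simpa using hC)
          (by simpa using heC) (by simp [(sign_or _ heC).resolve_left hXe])
      refine ⟨X, hX, hXe, fun x hx => ?_, fun x hx => ?_⟩
      · by_contra h
        rcases hCs h with rfl | h
        exacts [hR hx, Set.disjoint_left.1 hRG hx h]
      · by_cases h : X x = 0
        · exact h.ge
        · obtain rfl := (hCs h).resolve_right hx
          rw [hXe]
          decide
    · right
      obtain ⟨D, hD, heD, hDG⟩ := exists_isCocircuit_of_notMem_closure he hcl
      obtain ⟨Y, hY, rfl⟩ := exists_cocircuit_support_eq hD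
      wlog hYe : Y e = 1 generalizing Y
      · exact this (-Y) (neg_mem_cocircuits hY) (by simpa using hD) (by simpa using heD)
          (by simpa using hDG)
          (by simp [(sign_or _ heD).resolve_left hYe])
      have hYG : ∀ x ∈ G, Y x = 0 := fun x hx => by
        by_contra h
        exact Set.disjoint_left.1 hDG h hx
      refine ⟨Y, hY, hYe, hYG, fun x hx => ?_⟩
      by_cases h : Y x = 0
      · exact h.ge
      · by_cases hxG : x ∈ G
        · exact absurd (hYG x hxG) h
        · rw [hB x (hD.subset_ground h) hx hxG, hYe]
          decide

theorem dualPair : DualPair M.E M.circuits M.cocircuits where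
  orthogonal X hX _ hY := hY.2 X hX
  neg_left := M.neg_mem
  neg_right _ := neg_mem_cocircuits
  colouring := M.colouring

end Pairs

/-! ### Reorientation of circuits and cocircuits. -/

section Reorient

variable {α : Type*} [LinearOrder α] (M : OrientedMatroid α)

theorem flip_comp (A B : Finset α) (X : α → SignType) :
    flip A (flip B X) = flip (symmDiff A B) X := by
  funext e
  by_cases hA : e ∈ A <;> by_cases hB : e ∈ B <;> simp [flip, hA, hB, Finset.mem_symmDiff]

theorem flip_apply_mul_flip_apply (A : Finset α) (X Y : α → SignType) (e : α) :
    flip A X e * flip A Y e = X e * Y e := by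
  by_cases h : e ∈ A <;> simp [flip, h]

theorem orthogonal_flip_iff (A : Finset α) (X Y : α → SignType) :
    Orthogonal (flip A X) (flip A Y) ↔ Orthogonal X Y := by
  simp only [Orthogonal, flip_apply_mul_flip_apply]

theorem mem_reorient_circuits {A : Finset α} {X : α → SignType} :
    X ∈ (M.reorient A).circuits ↔ flip A X ∈ M.circuits := Iff.rfl

theorem reorient_toMatroid (A : Finset α) : (M.reorient A).toMatroid = M.toMatroid := by
  refine Matroid.ext_indep rfl fun I hI => ?_
  change (M.reorient A).IndepSet I ↔ M.IndepSet I
  refine and_congr Iff.rfl ⟨fun h X hX => ?_, fun h X hX => ?_⟩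
  · rw [← support_flip A X]
    exact h (flip A X) (by rwa [mem_reorient_circuits, flip_flip])
  · rw [← support_flip A X]
    exact h _ hX

theorem mem_reorient_cocircuits {A : Finset α} {Y : α → SignType} :
    Y ∈ (M.reorient A).cocircuits ↔ flip A Y ∈ M.cocircuits := by
  change (_ ∧ _) ↔ (_ ∧ _)
  rw [reorient_toMatroid, support_flip]
  refine and_congr Iff.rfl ⟨fun h X hX => ?_, fun h X hX => ?_⟩
  · rw [← orthogonal_flip_iff A, flip_flip]
    exact h _ (by rwa [mem_reorient_circuits, flip_flip])
  · rw [← orthogonal_flip_iff A]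
    exact h _ hX

theorem mem_reorient_symmDiff_circuits {A B : Finset α} {X : α → SignType} :
    X ∈ (M.reorient (symmDiff A B)).circuits ↔ flip B X ∈ (M.reorient A).circuits := by
  rw [mem_reorient_circuits, mem_reorient_circuits, flip_comp]

theorem mem_reorient_symmDiff_cocircuits {A B : Finset α} {X : α → SignType} :
    X ∈ (M.reorient (symmDiff A B)).cocircuits ↔ flip B X ∈ (M.reorient A).cocircuits := by
  rw [mem_reorient_cocircuits, mem_reorient_cocircuits, flip_comp]

end Reorient

/-! ### Minima of positive vectors in minors, and the effect of flipping the greatest element. -/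

section Activity

variable {α : Type*} [LinearOrder α]

/-- In the minor on `F` obtained by deleting `Z` and contracting the other elements, there is a
vector of `V` that is nonnegative and has minimum `a`. -/
def HasMin (V : Set (α → SignType)) (F : Finset α) (Z : Set α) (a : α) : Prop :=
  ∃ X ∈ V, X a = 1 ∧ (∀ x ∈ Z, X x = 0) ∧ ∀ x ∈ F, 0 ≤ X x ∧ (x < a → X x = 0)

/-- As `HasMin`, for vectors with sign `s` at `w`. -/
def HasMinSign (V : Set (α → SignType)) (F : Finset α) (Z : Set α) (w : α) (s : SignType)
    (a : α) : Prop :=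
  ∃ X ∈ V, X w = s ∧ X a = 1 ∧ (∀ x ∈ Z, X x = 0) ∧ ∀ x ∈ F, 0 ≤ X x ∧ (x < a → X x = 0)

variable {E F : Finset α} {V W : Set (α → SignType)} {C D : Set α} {w : α}

theorem hasMin_iff (V : Set (α → SignType)) (F : Finset α) (Z : Set α) (w a : α) :
    HasMin V F Z a ↔
      HasMinSign V F Z w 1 a ∨ HasMinSign V F Z w (-1) a ∨ HasMinSign V F Z w 0 a := by
  constructor
  · rintro ⟨X, hX, h⟩
    have : ∀ s : SignType, s = 1 ∨ s = -1 ∨ s = 0 := by decide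
    rcases this (X w) with h' | h' | h'
    exacts [Or.inl ⟨X, hX, h', h⟩, Or.inr (Or.inl ⟨X, hX, h', h⟩),
      Or.inr (Or.inr ⟨X, hX, h', h⟩)]
  · rintro (⟨X, hX, -, h⟩ | ⟨X, hX, -, h⟩ | ⟨X, hX, -, h⟩) <;> exact ⟨X, hX, h⟩

theorem hasMin_insert_zero (V : Set (α → SignType)) (F : Finset α) (Z : Set α) (w a : α) :
    HasMin V F (insert w Z) a ↔ HasMinSign V F Z w 0 a := by
  constructor
  · rintro ⟨X, hX, ha, hZ, h⟩
    exact ⟨X, hX, hZ w (Set.mem_insert _ _), ha, fun x hx => hZ x (Or.inr hx), h⟩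
  · rintro ⟨X, hX, hw, ha, hZ, h⟩
    refine ⟨X, hX, ha, ?_, h⟩
    rintro x (rfl | hx)
    exacts [hw, hZ x hx]

theorem hasMin_insert (V : Set (α → SignType)) (Z : Set α) {a : α}
    (hw : a < w) : HasMin V (insert w F) Z a ↔
      HasMinSign V F Z w 1 a ∨ HasMinSign V F Z w 0 a := by
  have sg : ∀ s : SignType, 0 ≤ s → s = 1 ∨ s = 0 := by decide
  constructor
  · rintro ⟨X, hX, ha, hZ, h⟩
    rcases sg _ (h w (Finset.mem_insert_self _ _)).1 with h' | h'
    · exact Or.inl ⟨X, hX, h', ha, hZ, fun x hx => h x (Finset.mem_insert_of_mem hx)⟩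
    · exact Or.inr ⟨X, hX, h', ha, hZ, fun x hx => h x (Finset.mem_insert_of_mem hx)⟩
  · have : ∀ X ∈ V, 0 ≤ X w → X a = 1 → (∀ x ∈ Z, X x = 0) →
        (∀ x ∈ F, 0 ≤ X x ∧ (x < a → X x = 0)) → HasMin V (insert w F) Z a := by
      intro X hX h0 ha hZ h
      refine ⟨X, hX, ha, hZ, fun x hx => ?_⟩
      rcases Finset.mem_insert.1 hx with rfl | hx
      exacts [⟨h0, fun h => absurd h hw.not_gt⟩, h x hx]
    rintro (⟨X, hX, h', ha, hZ, h⟩ | ⟨X, hX, h', ha, hZ, h⟩)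
    · exact this X hX (by rw [h']; decide) ha hZ h
    · exact this X hX h'.ge ha hZ h

/-- All of `F` lies below `w`, so a vector with minimum `w` is `w` alone in the minor. For circuits
this says that `w` is a loop, for cocircuits a coloop. -/
theorem hasMin_insert_self (V : Set (α → SignType)) (Z : Set α)
    (hw : ∀ x ∈ F, x < w) : HasMin V (insert w F) Z w ↔
      ∃ X ∈ V, X w = 1 ∧ (∀ x ∈ Z, X x = 0) ∧ ∀ x ∈ F, X x = 0 := by
  constructor
  · rintro ⟨X, hX, ha, hZ, h⟩
    exact ⟨X, hX, ha, hZ, fun x hx => (h x (Finset.mem_insert_of_mem hx)).2 (hw x hx)⟩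
  · rintro ⟨X, hX, ha, hZ, h⟩
    refine ⟨X, hX, ha, hZ, fun x hx => ?_⟩
    rcases Finset.mem_insert.1 hx with rfl | hx
    · exact ⟨by rw [ha]; decide, fun h => absurd h (lt_irrefl _)⟩
    · exact ⟨(h x hx).ge, fun _ => h x hx⟩

theorem hasMinSign_flip {V V' : Set (α → SignType)}
    (hV : ∀ X, X ∈ V' ↔ flip {w} X ∈ V) (hw : w ∉ F) (Z : Set α) (hZ : w ∉ Z) (s : SignType)
    {a : α} (ha : a ≠ w) : HasMinSign V' F Z w s a ↔ HasMinSign V F Z w (-s) a := by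
  have hfl : ∀ (X : α → SignType) x, x ≠ w → flip {w} X x = X x := fun X x hx => by
    simp [flip, hx]
  have hflw : ∀ X : α → SignType, flip {w} X w = -X w := fun X => by simp [flip]
  have one : ∀ {V V' : Set (α → SignType)} {s : SignType}, (∀ X, X ∈ V' ↔ flip {w} X ∈ V) →
      HasMinSign V' F Z w s a → HasMinSign V F Z w (-s) a := by
    rintro V V' s hV ⟨X, hX, hXw, hXa, hXZ, hXF⟩
    refine ⟨flip {w} X, (hV X).1 hX, by rw [hflw, hXw], by rw [hfl X a ha, hXa],
      fun x hx => ?_, fun x hx => ?_⟩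
    · rw [hfl X x (by rintro rfl; exact hZ hx), hXZ x hx]
    · rw [hfl X x (by rintro rfl; exact hw hx)]
      exact hXF x hx
  refine ⟨one hV, fun h => ?_⟩
  have := one (V := V') (V' := V) (fun X => by rw [hV, flip_flip]) h
  rwa [neg_neg] at this

section Step

variable (hp : DualPair E V W) (hFE : F ⊆ E) (hwF : ∀ x ∈ F, x < w) (hwC : w ∉ C) (hwD : w ∉ D)
  (hFC : ∀ x ∈ F, x ∉ C) (hFD : ∀ x ∈ F, x ∉ D) (hCD : Disjoint C D)
  (hcover : ∀ x, x = w ∨ x ∈ F ∨ x ∈ C ∨ x ∈ D)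

include hp hFE hwF hwC hFC hFD hCD in
-- Colour `w`, `D` and the part of `F` below `a` red, and `C` green. The vector of `W` is a
-- certificate of failure, unconstrained at `w` and below `a`.
theorem DualPair.exists_of_not_hasMinSign {a : α} (ha : a ∈ F)
    (h : ¬ HasMinSign V F D w 0 a) :
    ∃ Y ∈ W, Y a = 1 ∧ (∀ x ∈ C, Y x = 0) ∧ ∀ x ∈ F, a ≤ x → 0 ≤ Y x := by
  rcases hp.colouring a (hFE ha) (insert w (D ∪ {x | x ∈ F ∧ x < a})) C
    (by
      rintro (h | h | h)
      exacts [(hwF a ha).ne h, hFD a ha h, lt_irrefl _ h.2]) (hFC a ha)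
    (by
      rw [Set.disjoint_left]
      rintro x (rfl | hx | hx) hxC
      exacts [hwC hxC, Set.disjoint_left.1 hCD hxC hx, hFC x hx.1 hxC]) with
    ⟨X, hX, hXa, hXR, hXG⟩ | ⟨Y, hY, hYa, hYG, hYR⟩
  · exact absurd ⟨X, hX, hXR w (Or.inl rfl), hXa, fun x hx => hXR x (Or.inr (Or.inl hx)),
      fun x hx => ⟨hXG x (hFC x hx), fun hxa => hXR x (Or.inr (Or.inr ⟨hx, hxa⟩))⟩⟩ h
  · refine ⟨Y, hY, hYa, hYG, fun x hx hax => hYR x ?_⟩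
    rintro (h | h | h)
    exacts [(hwF x hx).ne h, hFD x hx h, hax.not_gt h.2]

include hp hFE hwF hwC hFC hFD hCD hcover

/-- Otherwise take the certificate `Y` at `a`. Against vectors that are nonnegative on `F` and
vanish below `a`, its products can be negative only at `w`. The first vector forces a negative
product at `w`; the second, opposite at `w`, then has a positive one there and nowhere a negative
one. -/
theorem DualPair.hasMinSign_zero_of_opposite {s : SignType} {a b : α} (ha : a ∈ F)
    (hab : a ≤ b) (h1 : HasMinSign V F D w s a) (h2 : HasMinSign V F D w (-s) b) :
    HasMinSign V F D w 0 a := by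
  by_contra hcon
  obtain ⟨Y, hY, hYa, hYC, hYF⟩ :=
    hp.exists_of_not_hasMinSign hFE hwF hwC hFC hFD hCD ha hcon
  obtain ⟨X, hX, hXw, hXa, hXD, hXF⟩ := h1
  obtain ⟨X', hX', hX'w, hX'b, hX'D, hX'F⟩ := h2
  have hnn : ∀ c d : SignType, 0 ≤ c → 0 ≤ d → c * d ≠ -1 := by decide
  have key : ∀ T ∈ V, (∀ x ∈ D, T x = 0) → (∀ x ∈ F, 0 ≤ T x ∧ (x < a → T x = 0)) →
      ∀ x, T x * Y x = -1 → x = w := by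
    intro T hT hTD hTF x hx
    rcases hcover x with h | h | h | h
    · exact h
    · rcases lt_or_ge x a with hxa | hxa
      · simp [(hTF x h).2 hxa] at hx
      · exact absurd hx (hnn _ _ (hTF x h).1 (hYF x h hxa))
    · simp [hYC x h] at hx
    · simp [hTD x h] at hx
  obtain ⟨x, hx⟩ := (hp.orthogonal X hX Y hY).exists_neg (e := a) (by rw [hXa, hYa]; decide)
  obtain rfl := key X hX hXD hXF x hx
  obtain ⟨y, hy⟩ := (hp.orthogonal X' hX' Y hY).exists_neg (e := x) (by
    rw [hXw] at hx
    rw [hX'w, neg_mul, hx, neg_neg])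
  obtain rfl := key X' hX' hX'D (fun x hx => ⟨(hX'F x hx).1,
    fun h => (hX'F x hx).2 (h.trans_le hab)⟩) y hy
  rw [hXw] at hx
  rw [hX'w, neg_mul, hx] at hy
  revert hy
  decide

omit hFE hwF hwC hFC hFD hCD in
-- The product at `w` is positive and none is negative elsewhere.
theorem DualPair.not_hasMinSign_of_hasMinSign {s : SignType} (hs : s ≠ 0) {a b : α}
    (h1 : HasMinSign V F D w s a) (h2 : HasMinSign W F C w s b) : False := by
  obtain ⟨X, hX, hXw, hXa, hXD, hXF⟩ := h1
  obtain ⟨Y, hY, hYw, hYa, hYC, hYF⟩ := h2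
  have hnn : ∀ c d : SignType, 0 ≤ c → 0 ≤ d → c * d ≠ -1 := by decide
  have hsq : ∀ s : SignType, s ≠ 0 → s * s = 1 := by decide
  have h1 : X w * Y w = 1 := by rw [hXw, hYw, hsq s hs]
  obtain ⟨x, hx⟩ := (hp.orthogonal X hX Y hY).exists_neg h1
  rcases hcover x with rfl | h | h | h
  · rw [h1] at hx
    revert hx
    decide
  · exact hnn _ _ (hXF x h).1 (hYF x h).1 hx
  · simp [hYC x h] at hx
  · simp [hXD x h] at hx

/-- Given failures for both signs, the one with the smaller minimum contradicts
`hasMinSign_zero_of_opposite`. -/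
theorem DualPair.forall_or_forall :
    (∀ a ∈ F, HasMinSign V F D w 1 a → HasMinSign V F D w 0 a) ∨
      (∀ a ∈ F, HasMinSign V F D w (-1) a → HasMinSign V F D w 0 a) := by
  by_contra! h
  obtain ⟨⟨a, ha, h1, h2⟩, b, hb, h3, h4⟩ := h
  rcases le_total a b with hab | hab
  · exact h2 (hp.hasMinSign_zero_of_opposite hFE hwF hwC hFC hFD hCD hcover ha hab h1 h3)
  · exact h4 (hp.hasMinSign_zero_of_opposite hFE hwF hwC hFC hFD hCD hcover (s := -1)
      hb hab h3 (by rwa [neg_neg]))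

include hwD in
/-- The two reorientations that differ in the greatest element `w` have the minima of the
deletion and of the contraction, in one order or the other. -/
theorem DualPair.hasMin_dichotomy {V' W' : Set (α → SignType)}
    (hV : ∀ X, X ∈ V' ↔ flip {w} X ∈ V) (hW : ∀ X, X ∈ W' ↔ flip {w} X ∈ W) :
    (∀ a ∈ F, (HasMin V (insert w F) D a ↔ HasMin V F (insert w D) a) ∧
      (HasMin W (insert w F) C a ↔ HasMin W F C a) ∧
      (HasMin V' (insert w F) D a ↔ HasMin V F D a) ∧
      (HasMin W' (insert w F) C a ↔ HasMin W F (insert w C) a)) ∨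
    (∀ a ∈ F, (HasMin V' (insert w F) D a ↔ HasMin V F (insert w D) a) ∧
      (HasMin W' (insert w F) C a ↔ HasMin W F C a) ∧
      (HasMin V (insert w F) D a ↔ HasMin V F D a) ∧
      (HasMin W (insert w F) C a ↔ HasMin W F (insert w C) a)) := by
  have hwF' : w ∉ F := fun h => lt_irrefl _ (hwF w h)
  have hA := hp.forall_or_forall hFE hwF hwC hFC hFD hCD hcover
  have hB := hp.symm.forall_or_forall (C := D) (D := C) hFE hwF hwD hFD hFC hCD.symm
    (fun x => (hcover x).imp id (Or.imp id Or.symm))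
  have hAB : ∀ {s : SignType}, s ≠ 0 → ∀ {a b}, HasMinSign V F D w s a →
      HasMinSign W F C w s b → False := fun hs _ _ h1 h2 =>
    hp.not_hasMinSign_of_hasMinSign hcover hs h1 h2
  have e1 : ∀ a ∈ F, (HasMin V (insert w F) D a ↔
      HasMinSign V F D w 1 a ∨ HasMinSign V F D w 0 a) := fun a ha => hasMin_insert V D (hwF a ha)
  have e2 : ∀ a ∈ F, (HasMin W (insert w F) C a ↔
      HasMinSign W F C w 1 a ∨ HasMinSign W F C w 0 a) := fun a ha => hasMin_insert W C (hwF a ha)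
  have e3 : ∀ a ∈ F, (HasMin V' (insert w F) D a ↔
      HasMinSign V F D w (-1) a ∨ HasMinSign V F D w 0 a) := fun a ha => by
    rw [hasMin_insert V' D (hwF a ha), hasMinSign_flip hV hwF' D hwD _ (hwF a ha).ne,
      hasMinSign_flip hV hwF' D hwD _ (hwF a ha).ne, neg_zero]
  have e4 : ∀ a ∈ F, (HasMin W' (insert w F) C a ↔
      HasMinSign W F C w (-1) a ∨ HasMinSign W F C w 0 a) := fun a ha => by
    rw [hasMin_insert W' C (hwF a ha), hasMinSign_flip hW hwF' C hwC _ (hwF a ha).ne,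
      hasMinSign_flip hW hwF' C hwC _ (hwF a ha).ne, neg_zero]
  simp only [hasMin_insert_zero, hasMin_iff V F D w, hasMin_iff W F C w]
  have n1 : (1 : SignType) ≠ 0 := by decide
  have n2 : (-1 : SignType) ≠ 0 := by decide
  -- `p`, `q`, `r` stand for minima attained with sign +, -, 0 at `w` in `V`, and the primed ones in
  -- `W`. In `V`, deletion sees `r` and contraction all three; in `W` these roles are exchanged. The
  -- two reorientations see `p ∨ r` and `q ∨ r`. When the choices for `V` and `W` clash, `hAB`
  -- excludes a sign and one side becomes indifferent.
  have prop1 : ∀ {p q r p' q' r' : Prop}, (p → r) → (q' → r') →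
      ((p ∨ r ↔ r) ∧ (p' ∨ r' ↔ p' ∨ q' ∨ r') ∧ (q ∨ r ↔ p ∨ q ∨ r) ∧ (q' ∨ r' ↔ r')) := by
    clear * -
    tauto
  have prop2 : ∀ {p q r p' q' r' : Prop}, (p → r) → (p' → r') → ¬ q →
      ((q ∨ r ↔ r) ∧ (q' ∨ r' ↔ p' ∨ q' ∨ r') ∧ (p ∨ r ↔ p ∨ q ∨ r) ∧ (p' ∨ r' ↔ r')) := by
    clear * -
    tauto
  have prop3 : ∀ {p q r p' q' r' : Prop}, (q → r) → ¬ p' →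
      ((q ∨ r ↔ r) ∧ (q' ∨ r' ↔ p' ∨ q' ∨ r') ∧ (p ∨ r ↔ p ∨ q ∨ r) ∧ (p' ∨ r' ↔ r')) := by
    clear * -
    tauto
  by_cases hP : ∀ a ∈ F, HasMinSign V F D w 1 a → HasMinSign V F D w 0 a
  · by_cases hQ : ∀ a ∈ F, HasMinSign W F C w (-1) a → HasMinSign W F C w 0 a
    · left
      intro a ha
      rw [e1 a ha, e2 a ha, e3 a ha, e4 a ha]
      exact prop1 (hP a ha) (hQ a ha)
    · right
      have hB' := hB.resolve_right hQ
      push Not at hQ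
      obtain ⟨b, hb, hb1, -⟩ := hQ
      intro a ha
      rw [e1 a ha, e2 a ha, e3 a ha, e4 a ha]
      exact prop2 (hP a ha) (hB' a ha) fun h => hAB n2 h hb1
  · right
    have hA' := hA.resolve_left hP
    push Not at hP
    obtain ⟨b, hb, hb1, -⟩ := hP
    intro a ha
    rw [e1 a ha, e2 a ha, e3 a ha, e4 a ha]
    exact prop3 (hA' a ha) fun h => hAB n1 hb1 h

/-- If `w` is a loop, deleting and contracting it have the same effect on the minima. -/
theorem DualPair.hasMin_of_loop {L : α → SignType} (hL : L ∈ V) (hLw : L w ≠ 0)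
    (hLF : ∀ x ∈ F, L x = 0) (hLD : ∀ x ∈ D, L x = 0) {a : α} (ha : a ∈ F) :
    (HasMin V F (insert w D) a ↔ HasMin V F D a) ∧
      (HasMin W F (insert w C) a ↔ HasMin W F C a) := by
  -- Outside `C` the loop `L` is `w` alone, so orthogonality makes `w` invisible to the vectors of
  -- `W` in the minor.
  have hY0 : ∀ Y ∈ W, (∀ x ∈ C, Y x = 0) → Y w = 0 := by
    intro Y hY hYC
    refine (hp.orthogonal L hL Y hY).eq_zero_of_unique hLw fun x hx => ?_
    rcases hcover x with h | h | h | h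
    exacts [absurd h hx, Or.inl (hLF x h), Or.inr (hYC x h), Or.inl (hLD x h)]
  constructor
  · refine ⟨fun ⟨X, hX, h1, h2, h3⟩ => ⟨X, hX, h1, fun x hx => h2 x (Or.inr hx), h3⟩, ?_⟩
    rintro ⟨X, hX, hXa, hXD, hXF⟩
    rw [hasMin_insert_zero]
    by_contra hcon
    obtain ⟨Y, hY, hYa, hYC, hYF⟩ :=
      hp.exists_of_not_hasMinSign hFE hwF hwC hFC hFD hCD ha hcon
    obtain ⟨x, hx⟩ := (hp.orthogonal X hX Y hY).exists_neg (e := a) (by rw [hXa, hYa]; decide)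
    have hnn : ∀ c d : SignType, 0 ≤ c → 0 ≤ d → c * d ≠ -1 := by decide
    rcases hcover x with rfl | h | h | h
    · simp [hY0 Y hY hYC] at hx
    · rcases lt_or_ge x a with hxa | hxa
      · simp [(hXF x h).2 hxa] at hx
      · exact hnn _ _ (hXF x h).1 (hYF x h hxa) hx
    · simp [hYC x h] at hx
    · simp [hXD x h] at hx
  · refine ⟨fun ⟨X, hX, h1, h2, h3⟩ => ⟨X, hX, h1, fun x hx => h2 x (Or.inr hx), h3⟩, ?_⟩
    rintro ⟨Y, hY, hYa, hYC, hYF⟩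
    refine ⟨Y, hY, hYa, ?_, hYF⟩
    rintro x (rfl | hx)
    exacts [hY0 Y hY hYC, hYC x hx]

end Step

end Activity

end OrientedMatroid

namespace OrientedMatroid

/-! ### The rank function. -/

section Rank

variable {α : Type*} (M : OrientedMatroid α)

/-- The rank function of the underlying matroid. -/
noncomputable def rk (S : Set α) : ℕ := (M.toMatroid.eRk S).toNat

instance : M.toMatroid.Finite := ⟨M.E.finite_toSet⟩

theorem eRk_ne_top (S : Set α) : M.toMatroid.eRk S ≠ ⊤ :=
  Matroid.eRk_ne_top_iff.2 (M.toMatroid.isRkFinite_set S)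

theorem rk_insert_of_mem_closure {S : Set α} {e : α} (he : e ∈ M.toMatroid.closure S) :
    M.rk (insert e S) = M.rk S := by
  unfold rk
  rw [← Matroid.eRk_closure_eq, Matroid.closure_insert_eq_of_mem_closure he,
    Matroid.eRk_closure_eq]

theorem rk_insert_of_notMem_closure {S : Set α} {e : α} (heE : e ∈ M.E)
    (he : e ∉ M.toMatroid.closure S) : M.rk (insert e S) = M.rk S + 1 := by
  unfold rk
  rw [Matroid.eRk_insert_eq_add_one ⟨heE, he⟩, ENat.toNat_add (M.eRk_ne_top S) (by simp)]
  rfl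

theorem rk_mono {S T : Set α} (h : S ⊆ T) : M.rk S ≤ M.rk T :=
  ENat.toNat_le_toNat (M.toMatroid.eRk_mono h) (M.eRk_ne_top T)

theorem rk_union_le (A : Finset α) (C : Set α) : M.rk (↑A ∪ C) ≤ A.card + M.rk C := by
  have h := M.toMatroid.eRk_union_le_encard_add_eRk A C
  unfold rk
  have h1 := ENat.toNat_le_toNat h (by simp [M.eRk_ne_top])
  rwa [ENat.toNat_add (by simp) (M.eRk_ne_top C), Set.encard_coe_eq_coe_finsetCard,
    ENat.toNat_natCast] at h1

theorem mem_closure_iff_exists_circuit {S : Set α} {e : α} (he : e ∉ S) :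
    e ∈ M.toMatroid.closure S ↔
      ∃ X ∈ M.circuits, Function.support X ⊆ insert e S ∧ X e ≠ 0 := by
  rw [Matroid.mem_closure_iff_exists_isCircuit he]
  constructor
  · rintro ⟨C, hCs, hC, heC⟩
    obtain ⟨X, hX, rfl⟩ := toMatroid_isCircuit_iff.1 hC
    exact ⟨X, hX, hCs, heC⟩
  · rintro ⟨X, hX, hXs, hXe⟩
    exact ⟨_, hXs, isCircuit_support hX, hXe⟩

end Rank

/-! ### Deletion-contraction for the Tutte polynomial of a minor. -/

section Tutte

variable {α : Type*} [LinearOrder α] (M : OrientedMatroid α) {R : Type*} [CommRing R] (x y : R)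

/-- The Tutte polynomial of the minor on `F` obtained by contracting `C`. -/
noncomputable def minorTutte (F : Finset α) (C : Set α) : R :=
  ∑ A ∈ F.powerset, (x - 1) ^ (M.rk (↑F ∪ C) - M.rk (↑A ∪ C)) *
    (y - 1) ^ (A.card + M.rk C - M.rk (↑A ∪ C))

variable {M} {F : Finset α} {C : Set α} {w : α}

/-- Adding `w` to `A` keeps the rank and raises the nullity by one: 1 + (y - 1) = y. The bound
`rk_union_le` keeps the truncated subtraction exact. -/
theorem minorTutte_insert_loop (hwF : w ∉ F) (hw : w ∈ M.toMatroid.closure C) :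
    M.minorTutte x y (insert w F) C = y * M.minorTutte x y F C := by
  unfold minorTutte
  rw [Finset.sum_powerset_insert hwF, Finset.mul_sum, ← Finset.sum_add_distrib]
  have hr : ∀ A : Finset α, M.rk (↑(insert w A) ∪ C) = M.rk (↑A ∪ C) := fun A => by
    rw [Finset.coe_insert, Set.insert_union]
    exact M.rk_insert_of_mem_closure (M.toMatroid.closure_subset_closure Set.subset_union_right hw)
  refine Finset.sum_congr rfl fun A hA => ?_
  have hwA : w ∉ A := fun h => hwF (Finset.mem_powerset.1 hA h)
  have := M.rk_union_le A C
  rw [hr, hr, Finset.card_insert_of_notMem hwA,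
    show A.card + 1 + M.rk C - M.rk (↑A ∪ C) = A.card + M.rk C - M.rk (↑A ∪ C) + 1 by omega]
  ring

/-- Adding `w` to `A` keeps the nullity and lowers the corank by one: (x - 1) + 1 = x. -/
theorem minorTutte_insert_coloop (hwF : w ∉ F) (hwE : w ∈ M.E)
    (hw : w ∉ M.toMatroid.closure (↑F ∪ C)) :
    M.minorTutte x y (insert w F) C = x * M.minorTutte x y F C := by
  unfold minorTutte
  rw [Finset.sum_powerset_insert hwF, Finset.mul_sum, ← Finset.sum_add_distrib]
  have hr : ∀ A : Finset α, A ⊆ F → M.rk (↑(insert w A) ∪ C) = M.rk (↑A ∪ C) + 1 := by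
    intro A hA
    rw [Finset.coe_insert, Set.insert_union]
    exact M.rk_insert_of_notMem_closure hwE fun h => hw (M.toMatroid.closure_subset_closure
      (Set.union_subset_union_left _ (Finset.coe_subset.2 hA)) h)
  refine Finset.sum_congr rfl fun A hA => ?_
  have hAF := Finset.mem_powerset.1 hA
  have hwA : w ∉ A := fun h => hwF (hAF h)
  have h1 := M.rk_union_le A C
  have h2 : M.rk (↑A ∪ C) ≤ M.rk (↑F ∪ C) :=
    M.rk_mono (Set.union_subset_union_left _ (Finset.coe_subset.2 hAF))
  rw [hr A hAF, hr F subset_rfl, Finset.card_insert_of_notMem hwA,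
    show A.card + 1 + M.rk C - (M.rk (↑A ∪ C) + 1) = A.card + M.rk C - M.rk (↑A ∪ C) by omega,
    show M.rk (↑F ∪ C) + 1 - M.rk (↑A ∪ C) = M.rk (↑F ∪ C) - M.rk (↑A ∪ C) + 1 by omega,
    Nat.add_sub_add_right]
  ring

/-- Subsets without `w` give the deletion, whose rank is unchanged because `w` is not a coloop.
Those with `w` give the contraction, where the rank of `C` grows by one because `w` is not a loop.
-/
theorem minorTutte_insert (hwF : w ∉ F) (hwE : w ∈ M.E) (hw : w ∈ M.toMatroid.closure (↑F ∪ C))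
    (hw' : w ∉ M.toMatroid.closure C) :
    M.minorTutte x y (insert w F) C =
      M.minorTutte x y F C + M.minorTutte x y F (insert w C) := by
  unfold minorTutte
  rw [Finset.sum_powerset_insert hwF]
  have h1 : M.rk (insert w (↑F ∪ C)) = M.rk (↑F ∪ C) := M.rk_insert_of_mem_closure hw
  have h2 : M.rk (insert w C) = M.rk C + 1 := M.rk_insert_of_notMem_closure hwE hw'
  congr 1
  · refine Finset.sum_congr rfl fun A hA => ?_
    rw [Finset.coe_insert, Set.insert_union, h1]
  · refine Finset.sum_congr rfl fun A hA => ?_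
    have hwA : w ∉ A := fun h => hwF (Finset.mem_powerset.1 hA h)
    rw [Finset.coe_insert, Finset.coe_insert, Set.insert_union, Set.insert_union,
      Set.union_insert, Set.union_insert, h2, Finset.card_insert_of_notMem hwA]
    congr 2
    omega

omit [LinearOrder α] in
theorem minorTutte_ground : M.minorTutte (MvPolynomial.X 0) (MvPolynomial.X 1) M.E ∅ = M.tutte := by
  unfold minorTutte tutte
  refine Finset.sum_congr rfl fun A hA => ?_
  simp [rk]

end Tutte

/-! ### The Tutte recursion for fixed reorientations. -/

section Count

variable {α : Type*} [LinearOrder α]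

open Classical in
/-- The minima of the nonnegative vectors in a minor on `F`. -/
noncomputable def minima (V : Set (α → SignType)) (F : Finset α) (Z : Set α) : Finset α :=
  F.filter (HasMin V F Z)

theorem mem_minima {V : Set (α → SignType)} {F : Finset α} {Z : Set α} {a : α} :
    a ∈ minima V F Z ↔ a ∈ F ∧ HasMin V F Z a := by
  classical simp [minima]

theorem minima_subset (V : Set (α → SignType)) (F : Finset α) (Z : Set α) :
    minima V F Z ⊆ F := fun _ ha => (mem_minima.1 ha).1

theorem minima_insert_of_not {V V' : Set (α → SignType)} {F : Finset α} {Z Z' : Set α} {w : α}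
    (hw : ¬ HasMin V (insert w F) Z w)
    (h : ∀ a ∈ F, HasMin V (insert w F) Z a ↔ HasMin V' F Z' a) :
    minima V (insert w F) Z = minima V' F Z' := by
  ext a
  simp only [mem_minima, Finset.mem_insert]
  constructor
  · rintro ⟨rfl | ha, h'⟩
    exacts [absurd h' hw, ⟨ha, (h a ha).1 h'⟩]
  · rintro ⟨ha, h'⟩
    exact ⟨Or.inr ha, (h a ha).2 h'⟩

theorem minima_insert_of {V V' : Set (α → SignType)} {F : Finset α} {Z Z' : Set α} {w : α}
    (hw : HasMin V (insert w F) Z w)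
    (h : ∀ a ∈ F, HasMin V (insert w F) Z a ↔ HasMin V' F Z' a) :
    minima V (insert w F) Z = insert w (minima V' F Z') := by
  ext a
  simp only [mem_minima, Finset.mem_insert]
  constructor
  · rintro ⟨rfl | ha, h'⟩
    exacts [Or.inl rfl, Or.inr ⟨ha, (h a ha).1 h'⟩]
  · rintro (rfl | ⟨ha, h'⟩)
    exacts [⟨Or.inl rfl, hw⟩, ⟨Or.inr ha, (h a ha).2 h'⟩]

theorem minima_congr {V V' : Set (α → SignType)} {F : Finset α} {Z Z' : Set α}
    (h : ∀ a ∈ F, HasMin V F Z a ↔ HasMin V' F Z' a) : minima V F Z = minima V' F Z' := by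
  classical exact Finset.filter_congr h

/-- The monomial of a reorientation `A` with active elements `O` and dual-active elements `P`
that do not meet `A`. -/
def fixedWeight {R : Type*} [CommRing R] (x y : R) (A O P : Finset α) : R :=
  if Disjoint A O ∧ Disjoint A P then x ^ P.card * y ^ O.card else 0

variable {R : Type*} [CommRing R] (x y : R) {A O P : Finset α} {w : α}

theorem fixedWeight_insert_left (hO : w ∉ O) (hP : w ∉ P) :
    fixedWeight x y (insert w A) O P = fixedWeight x y A O P := by
  simp [fixedWeight, hO, hP]

theorem fixedWeight_insert_active (hA : w ∉ A) (hO : w ∉ O) :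
    fixedWeight x y A (insert w O) P = y * fixedWeight x y A O P := by
  simp only [fixedWeight, Finset.disjoint_insert_right, hA, not_false_eq_true, true_and,
    Finset.card_insert_of_notMem hO, mul_ite, mul_zero]
  congr 1
  ring

theorem fixedWeight_insert_dualActive (hA : w ∉ A) (hP : w ∉ P) :
    fixedWeight x y A O (insert w P) = x * fixedWeight x y A O P := by
  simp only [fixedWeight, Finset.disjoint_insert_right, hA, not_false_eq_true, true_and,
    Finset.card_insert_of_notMem hP, mul_ite, mul_zero]
  congr 1
  ring

theorem fixedWeight_of_mem_active (hA : w ∈ A) (hO : w ∈ O) : fixedWeight x y A O P = 0 :=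
  if_neg fun h => Finset.disjoint_left.1 h.1 hA hO

theorem fixedWeight_of_mem_dualActive (hA : w ∈ A) (hP : w ∈ P) : fixedWeight x y A O P = 0 :=
  if_neg fun h => Finset.disjoint_left.1 h.2 hA hP

variable (M : OrientedMatroid α)

theorem symmDiff_singleton_of_notMem {A : Finset α} (h : w ∉ A) :
    symmDiff A {w} = insert w A := by
  ext z
  simp only [Finset.mem_symmDiff, Finset.mem_singleton, Finset.mem_insert]
  constructor
  · rintro (h | h)
    exacts [Or.inr h.1, Or.inl h.1]
  · rintro (rfl | hz)
    · exact Or.inr ⟨rfl, h⟩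
    · exact Or.inl ⟨hz, by rintro rfl; exact h hz⟩

/-- `C` and `D` vary because the induction moves `w` into either. Elements outside the ground set
must be put in one of them too, so that orthogonality can be evaluated everywhere. -/
theorem sum_fixedWeight_eq_minorTutte (F : Finset α) : F ⊆ M.E → ∀ C D : Set α,
    (∀ z ∈ F, z ∉ C) → (∀ z ∈ F, z ∉ D) → Disjoint C D → (∀ z, z ∈ F ∨ z ∈ C ∨ z ∈ D) →
    ∑ A ∈ F.powerset, fixedWeight x y A (minima (M.reorient A).circuits F D)
      (minima (M.reorient A).cocircuits F C) = M.minorTutte x y F C := by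
  induction F using Finset.induction_on_max with
  | empty => 
    intro _ C D _ _ _ _
    simp [minorTutte, fixedWeight, minima]
  | insert w F hwF ih =>
    intro hFE C D hFC hFD hCD hcover
    have hw' : w ∉ F := fun h => lt_irrefl _ (hwF w h)
    have hwC := hFC w (Finset.mem_insert_self _ _)
    have hwD := hFD w (Finset.mem_insert_self _ _)
    have hwE := hFE (Finset.mem_insert_self _ _)
    replace hFC : ∀ z ∈ F, z ∉ C := fun z hz => hFC z (Finset.mem_insert_of_mem hz)
    replace hFD : ∀ z ∈ F, z ∉ D := fun z hz => hFD z (Finset.mem_insert_of_mem hz)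
    replace hFE : F ⊆ M.E := fun z hz => hFE (Finset.mem_insert_of_mem hz)
    replace hcover : ∀ z, z = w ∨ z ∈ F ∨ z ∈ C ∨ z ∈ D := fun z => by
      simpa [or_assoc] using hcover z
    have hcover' : ∀ z, z = w ∨ z ∈ F ∨ z ∈ D ∨ z ∈ C :=
      fun z => (hcover z).imp id (Or.imp id Or.symm)
    have hne : ∀ z ∈ F, z ≠ w := fun z hz => (hwF z hz).ne
    have ihd := ih hFE C (insert w D) hFC
      (by rintro z hz (h | h); exacts [hne z hz h, hFD z hz h])
      (by rw [Set.disjoint_insert_right]; exact ⟨hwC, hCD⟩)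
      (fun z => by rcases hcover z with h | h | h | h <;> simp [h])
    have ihc := ih hFE (insert w C) D
      (by rintro z hz (h | h); exacts [hne z hz h, hFC z hz h]) hFD
      (by rw [Set.disjoint_insert_left]; exact ⟨hwD, hCD⟩)
      (fun z => by rcases hcover z with h | h | h | h <;> simp [h])
    have hp : ∀ A, DualPair M.E (M.reorient A).circuits (M.reorient A).cocircuits :=
      fun A => (M.reorient A).dualPair
    have hdich : ∀ A ∈ F.powerset, _ := fun A hA => (hp A).hasMin_dichotomy hFE hwF hwC hwD hFC
      hFD hCD hcover (V' := (M.reorient (insert w A)).circuits)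
      (W' := (M.reorient (insert w A)).cocircuits)
      (fun X => by
        rw [← symmDiff_singleton_of_notMem fun h => hw' (Finset.mem_powerset.1 hA h)]
        exact M.mem_reorient_symmDiff_circuits)
      (fun X => by
        rw [← symmDiff_singleton_of_notMem fun h => hw' (Finset.mem_powerset.1 hA h)]
        exact M.mem_reorient_symmDiff_cocircuits)
    have hmw : ∀ V Z, w ∉ minima V F Z := fun V Z h => hw' (minima_subset _ _ _ h)
    have hloop : w ∈ M.toMatroid.closure C → ∀ A, ∃ L ∈ (M.reorient A).circuits, L w = 1 ∧
        (∀ z ∈ D, L z = 0) ∧ ∀ z ∈ F, L z = 0 := by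
      intro h A
      rw [← M.reorient_toMatroid A, mem_closure_iff_exists_circuit _ hwC] at h
      obtain ⟨X, hX, hXs, hXw⟩ := h
      obtain ⟨L, hL, hLw, hLs⟩ := exists_sign_eq_one (hp A).neg_left hX hXw
      refine ⟨L, hL, hLw, fun z hz => (hLs z).2 ?_, fun z hz => (hLs z).2 ?_⟩
      · by_contra h
        rcases hXs h with rfl | h
        exacts [hwD hz, Set.disjoint_left.1 hCD h hz]
      · by_contra h
        rcases hXs h with rfl | h
        exacts [hw' hz, hFC z hz h]
    have hcoloop : w ∉ M.toMatroid.closure (↑F ∪ C) → ∀ A, ∃ L ∈ (M.reorient A).cocircuits,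
        L w = 1 ∧ (∀ z ∈ C, L z = 0) ∧ ∀ z ∈ F, L z = 0 := by
      intro h A
      rw [← M.reorient_toMatroid A] at h
      obtain ⟨K, hK, hwK, hKd⟩ := exists_isCocircuit_of_notMem_closure (M := M.reorient A) hwE h
      obtain ⟨X, hX, rfl⟩ := exists_cocircuit_support_eq hK
      obtain ⟨L, hL, hLw, hLs⟩ := exists_sign_eq_one (hp A).neg_right hX hwK
      refine ⟨L, hL, hLw, fun z hz => (hLs z).2 ?_, fun z hz => (hLs z).2 ?_⟩
      · by_contra h
        exact Set.disjoint_left.1 hKd h (Or.inr hz)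
      · by_contra h
        exact Set.disjoint_left.1 hKd h (Or.inl hz)
    have hnotloop : w ∉ M.toMatroid.closure C → ∀ A,
        ¬ HasMin (M.reorient A).circuits (insert w F) D w := by
      intro h A hm
      rw [hasMin_insert_self _ _ hwF] at hm
      obtain ⟨X, hX, hXw, hXD, hXF⟩ := hm
      refine h ?_
      rw [← M.reorient_toMatroid A, mem_closure_iff_exists_circuit _ hwC]
      refine ⟨X, hX, fun z hz => ?_, by rw [hXw]; decide⟩
      rcases hcover z with h | h | h | h
      exacts [Or.inl h, absurd (hXF z h) hz, Or.inr h, absurd (hXD z h) hz]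
    have hnotcoloop : w ∈ M.toMatroid.closure (↑F ∪ C) → ∀ A,
        ¬ HasMin (M.reorient A).cocircuits (insert w F) C w := by
      intro h A hm
      rw [hasMin_insert_self _ _ hwF] at hm
      obtain ⟨Y, hY, hYw, hYC, hYF⟩ := hm
      rw [← M.reorient_toMatroid A, mem_closure_iff_exists_circuit _ (by simp [hw', hwC])] at h
      obtain ⟨X, hX, hXs, hXw⟩ := h
      refine absurd hYw ?_
      rw [((hp A).orthogonal X hX Y hY).eq_zero_of_unique hXw fun z hz => ?_]
      · decide
      · by_cases hXz : X z = 0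
        · exact Or.inl hXz
        · right
          rcases hXs hXz with h | h | h
          exacts [absurd h hz, hYF z h, hYC z h]
    rw [Finset.sum_powerset_insert hw', ← Finset.sum_add_distrib]
    by_cases hl : w ∈ M.toMatroid.closure C
    · rw [minorTutte_insert_loop x y hw' hl, ← ihd, Finset.mul_sum]
      refine Finset.sum_congr rfl fun A hA => ?_
      have hwA : w ∉ A := fun h => hw' (Finset.mem_powerset.1 hA h)
      have hm : ∀ B, HasMin (M.reorient B).circuits (insert w F) D w := fun B =>
        (hasMin_insert_self _ _ hwF).2 (hloop hl B)
      have hm' := hnotcoloop (M.toMatroid.closure_subset_closure Set.subset_union_right hl)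
      obtain ⟨L, hL, hLw, hLD, hLF⟩ := hloop hl A
      -- For a loop the two alternatives of the dichotomy coincide. The reorientation containing `w`
      -- has weight zero, as `w` is active in it.
      have hdc : ∀ a ∈ F, _ := fun a ha => (hp A).hasMin_of_loop hFE hwF hwC hFC hFD hCD hcover hL
        (by rw [hLw]; decide) hLF hLD ha
      have e1 : minima (M.reorient A).circuits (insert w F) D =
          insert w (minima (M.reorient A).circuits F (insert w D)) := by
        refine minima_insert_of (hm A) fun a ha => ?_
        rcases hdich A hA with h | h
        · exact (h a ha).1
        · exact (h a ha).2.2.1.trans (hdc a ha).1.symm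
      have e2 : minima (M.reorient A).cocircuits (insert w F) C =
          minima (M.reorient A).cocircuits F C := by
        refine minima_insert_of_not (hm' A) fun a ha => ?_
        rcases hdich A hA with h | h
        · exact (h a ha).2.1
        · exact (h a ha).2.2.2.trans (hdc a ha).2
      rw [fixedWeight_of_mem_active x y (Finset.mem_insert_self _ _)
        (mem_minima.2 ⟨Finset.mem_insert_self _ _, hm (insert w A)⟩), add_zero, e1, e2,
        fixedWeight_insert_active x y hwA (hmw _ _)]
    by_cases hc : w ∈ M.toMatroid.closure (↑F ∪ C)
    · rw [minorTutte_insert x y hw' hwE hc hl, ← ihd, ← ihc, ← Finset.sum_add_distrib]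
      refine Finset.sum_congr rfl fun A hA => ?_
      have hn := hnotloop hl
      have hn' := hnotcoloop hc
      rcases hdich A hA with h | h
      -- Here `insert w A` carries the minima of the contraction. As `w` is not among them, dropping
      -- it from the reorientation does not change the weight.
      · have hcon : fixedWeight x y A (minima (M.reorient A).circuits F D)
            (minima (M.reorient A).cocircuits F (insert w C)) =
            fixedWeight x y (insert w A) (minima (M.reorient (insert w A)).circuits (insert w F) D)
            (minima (M.reorient (insert w A)).cocircuits (insert w F) C) := by
          rw [minima_insert_of_not (hn _) fun a ha => (h a ha).2.2.1,
            minima_insert_of_not (hn' _) fun a ha => (h a ha).2.2.2,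
            fixedWeight_insert_left x y (hmw _ _) (hmw _ _)]
        rw [hcon, minima_insert_of_not (hn A) fun a ha => (h a ha).1,
          minima_insert_of_not (hn' A) fun a ha => (h a ha).2.1]
      · have hdel : fixedWeight x y A (minima (M.reorient A).circuits F (insert w D))
            (minima (M.reorient A).cocircuits F C) =
            fixedWeight x y (insert w A) (minima (M.reorient (insert w A)).circuits (insert w F) D)
            (minima (M.reorient (insert w A)).cocircuits (insert w F) C) := by
          rw [minima_insert_of_not (hn _) fun a ha => (h a ha).1,
            minima_insert_of_not (hn' _) fun a ha => (h a ha).2.1,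
            fixedWeight_insert_left x y (hmw _ _) (hmw _ _)]
        rw [hdel, minima_insert_of_not (hn A) fun a ha => (h a ha).2.2.1,
          minima_insert_of_not (hn' A) fun a ha => (h a ha).2.2.2, add_comm]
    · rw [minorTutte_insert_coloop x y hw' hwE hc, ← ihd, Finset.mul_sum]
      refine Finset.sum_congr rfl fun A hA => ?_
      have hwA : w ∉ A := fun h => hw' (Finset.mem_powerset.1 hA h)
      have hm : ∀ B, HasMin (M.reorient B).cocircuits (insert w F) C w := fun B =>
        (hasMin_insert_self _ _ hwF).2 (hcoloop hc B)
      have hm' := hnotloop hl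
      obtain ⟨L, hL, hLw, hLC, hLF⟩ := hcoloop hc A
      have hdc : ∀ a ∈ F, _ := fun a ha => (hp A).symm.hasMin_of_loop hFE hwF hwD hFD hFC hCD.symm
        hcover' hL (by rw [hLw]; decide) hLF hLC ha
      have e1 : minima (M.reorient A).cocircuits (insert w F) C =
          insert w (minima (M.reorient A).cocircuits F C) := by
        refine minima_insert_of (hm A) fun a ha => ?_
        rcases hdich A hA with h | h
        · exact (h a ha).2.1
        · exact (h a ha).2.2.2.trans (hdc a ha).1
      have e2 : minima (M.reorient A).circuits (insert w F) D =
          minima (M.reorient A).circuits F (insert w D) := by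
        refine minima_insert_of_not (hm' A) fun a ha => ?_
        rcases hdich A hA with h | h
        · exact (h a ha).1
        · exact (h a ha).2.2.1.trans (hdc a ha).2.symm
      rw [fixedWeight_of_mem_dualActive x y (Finset.mem_insert_self _ _)
        (mem_minima.2 ⟨Finset.mem_insert_self _ _, hm (insert w A)⟩), add_zero, e1, e2,
        fixedWeight_insert_dualActive x y hwA (hmw _ _)]

end Count

end OrientedMatroid

namespace OrientedMatroid

/-! ### Active partitions and their invariance under flipping parts. -/

section Parts

variable {α : Type*} [LinearOrder α]

/-- The union of the supports of the nonnegative members of `V` that vanish on `L`. -/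
def posUnion (V : Set (α → SignType)) (L : Set α) : Set α :=
  {x | ∃ X ∈ V, (∀ z, 0 ≤ X z) ∧ X x = 1 ∧ ∀ z ∈ L, X z = 0}

omit [LinearOrder α] in
theorem posUnion_anti (V : Set (α → SignType)) {L L' : Set α} (h : L ⊆ L') :
    posUnion V L' ⊆ posUnion V L := fun _ ⟨X, hX, h0, hx, hL⟩ =>
  ⟨X, hX, h0, hx, fun z hz => hL z (h hz)⟩

omit [LinearOrder α] in
theorem notMem_of_mem_posUnion {V : Set (α → SignType)} {L : Set α} {x : α}
    (hx : x ∈ posUnion V L) : x ∉ L := by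
  obtain ⟨X, -, -, h1, h2⟩ := hx
  intro h
  rw [h2 x h] at h1
  revert h1
  decide

omit [LinearOrder α] in
theorem mem_posUnion_of_ne_zero {V : Set (α → SignType)} {L : Set α} {X : α → SignType}
    (hX : X ∈ V) (h0 : ∀ z, 0 ≤ X z) (hL : ∀ z ∈ L, X z = 0) {x : α} (hx : X x ≠ 0) :
    x ∈ posUnion V L := by
  have sg : ∀ s : SignType, 0 ≤ s → s ≠ 0 → s = 1 := by decide
  exact ⟨X, hX, h0, sg _ (h0 x) hx, hL⟩

omit [LinearOrder α] in
theorem Orthogonal.exists_of_ne_zero {X Y : α → SignType} (h : Orthogonal X Y) {e : α}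
    (hX : X e ≠ 0) (hY : Y e ≠ 0) : (∃ f, X f * Y f = 1) ∧ ∃ f, X f * Y f = -1 := by
  have sg : ∀ a b : SignType, a ≠ 0 → b ≠ 0 → a * b = 1 ∨ a * b = -1 := by decide
  rcases sg _ _ hX hY with h' | h'
  exacts [⟨⟨e, h'⟩, h.1 ⟨e, h'⟩⟩, ⟨h.2 ⟨e, h'⟩, ⟨e, h'⟩⟩]

variable {E : Finset α} {V W V' W' : Set (α → SignType)}

omit [LinearOrder α] in
-- A common element would give a positive product and no negative one.
theorem DualPair.disjoint_posUnion (hp : DualPair E V W) (L L' : Set α) :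
    Disjoint (posUnion V L) (posUnion W L') := by
  rw [Set.disjoint_left]
  rintro x ⟨X, hX, hX0, hXx, -⟩ ⟨Y, hY, hY0, hYx, -⟩
  obtain ⟨z, hz⟩ := (hp.orthogonal X hX Y hY).exists_neg (e := x) (by rw [hXx, hYx]; decide)
  have hnn : ∀ c d : SignType, 0 ≤ c → 0 ≤ d → c * d ≠ -1 := by decide
  exact hnn _ _ (hX0 z) (hY0 z) hz

variable {S : Finset α} {L₀ : Set α}

section Flip

variable (hp : DualPair E V W) (hp' : DualPair E V' W')
  (hE : ∀ X ∈ V, Function.support X ⊆ E) (hE' : ∀ X ∈ V', Function.support X ⊆ E)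
  (hV : ∀ X, X ∈ V' ↔ flip S X ∈ V) (hW : ∀ X, X ∈ W' ↔ flip S X ∈ W)
  (hL₀ : IsLowerSet L₀) (hS : (S : Set α) = posUnion V L₀)

include hp hp' hE hW hL₀ hS in
-- If `x` were lost, colouring `L` red in the flipped pair would give a `Y` nonnegative off `L` with
-- `Y x = 1`. Unflipped, it is nonpositive on `S \ L`, hence vanishes on every nonnegative vector of
-- `V` supported there. Lower sets of a linear order are nested, which leaves two cases.
theorem DualPair.posUnion_subset_flip {L : Set α} (hL : IsLowerSet L) :
    posUnion V L ⊆ posUnion V' L := by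
  rintro x ⟨X, hX, hX0, hXx, hXL⟩
  have hxL : x ∉ L := notMem_of_mem_posUnion ⟨X, hX, hX0, hXx, hXL⟩
  have hxE : x ∈ E := hE X hX (by rw [Function.mem_support, hXx]; decide)
  rcases hp'.colouring x hxE L ∅ hxL (by simp) (by simp) with
    ⟨X', hX', hX'x, hX'L, hX'0⟩ | ⟨Y, hY, hYx, -, hY0⟩
  · exact ⟨X', hX', fun z => hX'0 z (by simp), hX'x, hX'L⟩
  exfalso
  have hy := (hW Y).1 hY
  have hyS : ∀ z ∈ S, flip S Y z = -Y z := fun z hz => by simp [flip, hz]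
  have hyS' : ∀ z ∉ S, flip S Y z = Y z := fun z hz => by simp [flip, hz]
  have sg1 : ∀ a b : SignType, 0 ≤ a → 0 ≤ b → a * -b ≠ 1 := by decide
  have sg2 : ∀ a b : SignType, 0 ≤ a → 0 ≤ b → a * b ≠ -1 := by decide
  have key : ∀ T ∈ V, (∀ z, 0 ≤ T z) → (∀ z, T z ≠ 0 → z ∈ S ∧ z ∉ L) →
      ∀ z, T z ≠ 0 → flip S Y z = 0 := by
    intro T hT hT0 hTS z hTz
    by_contra hyz
    obtain ⟨⟨u, hu⟩, -⟩ := (hp.orthogonal T hT _ hy).exists_of_ne_zero hTz hyz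
    have hTu : T u ≠ 0 := by
      intro h
      simp [h] at hu
    obtain ⟨h1, h2⟩ := hTS u hTu
    rw [hyS u h1] at hu
    exact sg1 _ _ (hT0 u) (hY0 u h2) hu
  have hy0 : flip S Y x ≠ 0 := by
    by_cases h : x ∈ S
    · rw [hyS x h, hYx]
      decide
    · rw [hyS' x h, hYx]
      decide
  have hXx0 : X x ≠ 0 := by
    rw [hXx]
    decide
  rcases hL.total hL₀ with hLL | hLL
  -- For `L ⊆ L₀` the vectors making up `S` avoid `L`, so flipping does not affect `Y`, and `X`
  -- contradicts orthogonality.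
  · have hSz : ∀ z ∈ S, flip S Y z = 0 := by
      intro z hz
      have hz' : z ∈ posUnion V L₀ := hS ▸ Finset.mem_coe.2 hz
      obtain ⟨T, hT, hT0, hTz, hTL⟩ := hz'
      refine key T hT hT0 (fun u hu => ?_) z (by rw [hTz]; decide)
      have h := mem_posUnion_of_ne_zero hT hT0 hTL hu
      exact ⟨Finset.mem_coe.1 (hS ▸ h), fun h' => notMem_of_mem_posUnion h (hLL h')⟩
    obtain ⟨-, z, hz⟩ := (hp.orthogonal X hX _ hy).exists_of_ne_zero hXx0 hy0
    by_cases hzS : z ∈ S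
    · simp [hSz z hzS] at hz
    · rw [hyS' z hzS] at hz
      refine sg2 _ _ (hX0 z) (hY0 z fun hzL => ?_) hz
      simp [hXL z hzL] at hz
  -- For `L₀ ⊆ L` the vector `X` itself is supported in `S \ L`.
  · refine hy0 (key X hX hX0 (fun u hu => ?_) x hXx0)
    exact ⟨Finset.mem_coe.1 (hS ▸ mem_posUnion_of_ne_zero hX hX0 (fun z hz => hXL z (hLL hz)) hu),
      fun h => hu (hXL u h)⟩

omit [LinearOrder α] in
include hp hS in
-- A vector making up `S` vanishes on `L₀`, so its products with `Y` are never negative and must all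
-- be zero.
theorem DualPair.eq_zero_of_nonneg_off {Y : α → SignType} (hY : Y ∈ W)
    (hY0 : ∀ z ∉ L₀, 0 ≤ Y z) : ∀ z ∈ S, Y z = 0 := by
  intro z hz
  have hz' : z ∈ posUnion V L₀ := hS ▸ Finset.mem_coe.2 hz
  obtain ⟨T, hT, hT0, hTz, hTL⟩ := hz'
  by_contra hYz
  obtain ⟨-, u, hu⟩ := (hp.orthogonal T hT Y hY).exists_of_ne_zero (by rw [hTz]; decide) hYz
  have sg2 : ∀ a b : SignType, 0 ≤ a → 0 ≤ b → a * b ≠ -1 := by decide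
  refine sg2 _ _ (hT0 u) (hY0 u fun h => ?_) hu
  simp [hTL u h] at hu

include hp hp' hE hE' hV hW hL₀ hS in
-- A new element `x` would have a colouring certificate `Y` nonnegative off `L₀`. It vanishes on
-- `S`, so it cannot see the flip and is not orthogonal to the unflipped `X'`. Knowing that `S` is
-- the same union after the flip makes flipping reversible in the inclusions.
theorem DualPair.posUnion_flip_self : posUnion V' L₀ = posUnion V L₀ := by
  refine (Set.Subset.antisymm (hp.posUnion_subset_flip hp' hE hW hL₀ hS hL₀) ?_).symm
  rintro x ⟨X', hX', hX'0, hX'x, hX'L⟩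
  by_contra hxS
  have hxL : x ∉ L₀ := notMem_of_mem_posUnion ⟨X', hX', hX'0, hX'x, hX'L⟩
  have hxE : x ∈ E := hE' X' hX' (by rw [Function.mem_support, hX'x]; decide)
  rcases hp.colouring x hxE L₀ ∅ hxL (by simp) (by simp) with
    ⟨X, hX, hXx, hXL, hX0⟩ | ⟨Y, hY, hYx, -, hY0⟩
  · exact hxS ⟨X, hX, fun z => hX0 z (by simp), hXx, hXL⟩
  have hYS := hp.eq_zero_of_nonneg_off hS hY hY0
  have hxS' : x ∉ S := fun h => hxS (hS ▸ Finset.mem_coe.2 h)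
  obtain ⟨z, hz⟩ := (hp.orthogonal _ ((hV X').1 hX') Y hY).exists_neg (e := x) (by
    simp [flip, hxS', hX'x, hYx])
  have sg2 : ∀ a b : SignType, 0 ≤ a → 0 ≤ b → a * b ≠ -1 := by decide
  by_cases hzS : z ∈ S
  · simp [hYS z hzS] at hz
  · simp only [flip, hzS, if_false] at hz
    refine sg2 _ _ (hX'0 z) (hY0 z fun h => ?_) hz
    simp [hX'L z h] at hz

include hp hS hW in
theorem DualPair.posUnion_right_subset_flip (L : Set α) : posUnion W L ⊆ posUnion W' L := by
  rintro x ⟨Y, hY, hY0, hYx, hYL⟩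
  refine ⟨Y, (hW Y).2 ?_, hY0, hYx, hYL⟩
  convert hY using 1
  funext z
  by_cases hz : z ∈ S
  · simp [flip, hz, hp.eq_zero_of_nonneg_off hS hY (fun z _ => hY0 z) z hz]
  · simp [flip, hz]

include hp hp' hE hE' hV hW hL₀ hS in
/-- Reorienting the union of the nonnegative vectors that vanish on a lower set does not change
any such union. -/
theorem DualPair.posUnion_flip {L : Set α} (hL : IsLowerSet L) :
    posUnion V' L = posUnion V L ∧ posUnion W' L = posUnion W L := by
  have hS' : (S : Set α) = posUnion V' L₀ := by
    rw [hS, hp.posUnion_flip_self hp' hE hE' hV hW hL₀ hS]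
  have hW' : ∀ X, X ∈ W ↔ flip S X ∈ W' := fun X => by rw [hW, flip_flip]
  exact ⟨(hp'.posUnion_subset_flip hp hE' hW' hL₀ hS' hL).antisymm
      (hp.posUnion_subset_flip hp' hE hW hL₀ hS hL),
    (hp'.posUnion_right_subset_flip hW' hS' L).antisymm
      (hp.posUnion_right_subset_flip hW hS L)⟩

end Flip

variable (M : OrientedMatroid α)

omit [LinearOrder α] in
theorem support_subset_of_mem_cocircuits {Y : α → SignType} (hY : Y ∈ M.cocircuits) :
    Function.support Y ⊆ M.E := hY.1.subset_ground

/-- The part with minimum `a` of the active partition; it is empty if `a` is neither active nor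
dual-active. -/
def part (a : α) : Set α := M.cyclicPart a ∪ M.acyclicPart a

/-- A vector vanishes on a lower set exactly when its minimum lies outside. This replaces minima by
conditions suited to the colouring lemma. -/
theorem sUnion_eq_posUnion {V : Set (α → SignType)} (hV : ∀ X ∈ V, Function.support X ⊆ M.E)
    {L : Set α} {p : α → Prop} (hp : ∀ m, p m ↔ m ∉ L)
    (hL : IsLowerSet L) :
    ⋃₀ {C | C ∈ {C | ∃ X ∈ V, (∀ e, 0 ≤ X e) ∧ Function.support X = C} ∧
      ∃ m, IsLeast C m ∧ p m} = posUnion V L := by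
  ext x
  constructor
  · rintro ⟨_, ⟨⟨X, hX, hX0, rfl⟩, m, hm, hpm⟩, hx⟩
    refine mem_posUnion_of_ne_zero hX hX0 (fun z hz => ?_) hx
    by_contra h
    exact (hp m).1 hpm (hL (hm.2 h) hz)
  · rintro ⟨X, hX, hX0, hXx, hXL⟩
    have hx : X x ≠ 0 := by
      rw [hXx]
      decide
    obtain ⟨m, hm⟩ := (M.E.finite_toSet.subset (hV X hX)).exists_minimal ⟨x, hx⟩
    refine ⟨_, ⟨⟨X, hX, hX0, rfl⟩, m, ⟨hm.1, fun z hz => ?_⟩, (hp m).2 fun h => hm.1 (hXL m h)⟩, hx⟩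
    exact (le_total m z).elim id fun h => hm.2 hz h

theorem cyclicPart_eq (a : α) :
    M.cyclicPart a = posUnion M.circuits (Set.Iio a) \ posUnion M.circuits (Set.Iic a) := by
  unfold cyclicPart posCircuits
  rw [M.sUnion_eq_posUnion M.support_subset (L := Set.Iio a)
      (by simp) (isLowerSet_Iio a),
    M.sUnion_eq_posUnion M.support_subset (L := Set.Iic a)
      (by simp) (isLowerSet_Iic a)]

theorem acyclicPart_eq (a : α) :
    M.acyclicPart a = posUnion M.cocircuits (Set.Iio a) \ posUnion M.cocircuits (Set.Iic a) := by
  unfold acyclicPart posCocircuits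
  rw [M.sUnion_eq_posUnion (fun _ => M.support_subset_of_mem_cocircuits)  (L := Set.Iio a) (by simp) (isLowerSet_Iio a),
    M.sUnion_eq_posUnion (fun _ => M.support_subset_of_mem_cocircuits)  (L := Set.Iic a) (by simp) (isLowerSet_Iic a)]

theorem isLeast_iff_mem_posUnion {V : Set (α → SignType)} {a : α} :
    (∃ C ∈ {C | ∃ X ∈ V, (∀ e, 0 ≤ X e) ∧ Function.support X = C}, IsLeast C a) ↔
      a ∈ posUnion V (Set.Iio a) := by
  constructor
  · rintro ⟨_, ⟨X, hX, hX0, rfl⟩, ha⟩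
    refine mem_posUnion_of_ne_zero hX hX0 (fun z hz => ?_) ha.1
    by_contra h
    exact absurd (ha.2 h) (not_le.2 hz)
  · rintro ⟨X, hX, hX0, hXa, hXL⟩
    refine ⟨_, ⟨X, hX, hX0, rfl⟩, by rw [Function.mem_support, hXa]; decide, fun z hz => ?_⟩
    by_contra h
    exact hz (hXL z (not_le.1 h))

theorem mem_activeElements_iff {a : α} :
    a ∈ M.activeElements ↔ a ∈ posUnion M.circuits (Set.Iio a) := isLeast_iff_mem_posUnion

theorem mem_dualActiveElements_iff {a : α} :
    a ∈ M.dualActiveElements ↔ a ∈ posUnion M.cocircuits (Set.Iio a) := isLeast_iff_mem_posUnion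

theorem posUnion_Iio_diff_Iic_eq_empty {V : Set (α → SignType)} {a : α}
    (ha : a ∉ posUnion V (Set.Iio a)) : posUnion V (Set.Iio a) \ posUnion V (Set.Iic a) = ∅ := by
  rw [Set.sdiff_eq_empty]
  rintro x ⟨X, hX, hX0, hXx, hXL⟩
  refine ⟨X, hX, hX0, hXx, fun z hz => ?_⟩
  rcases (Set.mem_Iic.1 hz).lt_or_eq with h | rfl
  · exact hXL z h
  · by_contra h
    exact ha (mem_posUnion_of_ne_zero hX hX0 hXL h)

theorem notMem_activeElements_or (a : α) :
    a ∉ M.activeElements ∨ a ∉ M.dualActiveElements := by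
  rw [mem_activeElements_iff, mem_dualActiveElements_iff]
  by_contra! h
  exact Set.disjoint_left.1 (M.dualPair.disjoint_posUnion _ _) h.1 h.2

theorem part_eq_cyclicPart {a : α} (ha : a ∈ M.activeElements) : M.part a = M.cyclicPart a := by
  have := (M.notMem_activeElements_or a).resolve_left (not_not.2 ha)
  rw [mem_dualActiveElements_iff] at this
  rw [part, acyclicPart_eq, posUnion_Iio_diff_Iic_eq_empty this, Set.union_empty]

theorem part_eq_acyclicPart {a : α} (ha : a ∈ M.dualActiveElements) :
    M.part a = M.acyclicPart a := by
  have := (M.notMem_activeElements_or a).resolve_right (not_not.2 ha)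
  rw [mem_activeElements_iff] at this
  rw [part, cyclicPart_eq, posUnion_Iio_diff_Iic_eq_empty this, Set.empty_union]

theorem activePartition_eq :
    M.activePartition = M.part '' (M.activeElements ∪ M.dualActiveElements) := by
  rw [Set.image_union, activePartition]
  congr 1
  · exact Set.image_congr fun a ha => (M.part_eq_cyclicPart ha).symm
  · exact Set.image_congr fun a ha => (M.part_eq_acyclicPart ha).symm

theorem mem_part_self {a : α} (ha : a ∈ M.activeElements ∪ M.dualActiveElements) :
    a ∈ M.part a := by
  have hn : ∀ V : Set (α → SignType), a ∉ posUnion V (Set.Iic a) := fun V h =>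
    notMem_of_mem_posUnion h Set.self_mem_Iic
  rw [part, cyclicPart_eq, acyclicPart_eq]
  rcases ha with ha | ha
  · exact Or.inl ⟨M.mem_activeElements_iff.1 ha, hn _⟩
  · exact Or.inr ⟨M.mem_dualActiveElements_iff.1 ha, hn _⟩

/-- The unions decrease as the initial segment grows, so their successive differences are disjoint;
cyclic and acyclic parts are disjoint by orthogonality. -/
theorem eq_of_mem_part {a b x : α} (ha : x ∈ M.part a) (hb : x ∈ M.part b) : a = b := by
  have key : ∀ {V : Set (α → SignType)} {a b : α},
      x ∈ posUnion V (Set.Iio a) \ posUnion V (Set.Iic a) →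
      x ∈ posUnion V (Set.Iio b) \ posUnion V (Set.Iic b) → ¬ a < b := fun ha hb hab =>
    ha.2 (posUnion_anti _ (fun z hz => lt_of_le_of_lt hz hab) hb.1)
  have hdisj := fun L L' => Set.disjoint_left.1 (M.dualPair.disjoint_posUnion L L')
  rw [part, cyclicPart_eq, acyclicPart_eq] at ha hb
  rcases ha with ha | ha <;> rcases hb with hb | hb
  · exact le_antisymm (not_lt.1 (key hb ha)) (not_lt.1 (key ha hb))
  · exact absurd hb.1 (hdisj _ _ ha.1)
  · exact absurd ha.1 (hdisj _ _ hb.1)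
  · exact le_antisymm (not_lt.1 (key hb ha)) (not_lt.1 (key ha hb))

omit [LinearOrder α] in
theorem posUnion_circuits_subset (L : Set α) : posUnion M.circuits L ⊆ M.E := by
  rintro x ⟨X, hX, -, hXx, -⟩
  exact M.support_subset X hX (by rw [Function.mem_support, hXx]; decide)

omit [LinearOrder α] in
theorem posUnion_cocircuits_subset (L : Set α) : posUnion M.cocircuits L ⊆ M.E := by
  rintro x ⟨X, hX, -, hXx, -⟩
  exact M.support_subset_of_mem_cocircuits hX (by rw [Function.mem_support, hXx]; decide)

/-- Two reorientations have the same unions of positive circuits, and of positive cocircuits,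
that avoid a given lower set. -/
def SameParts (A B : Finset α) : Prop :=
  ∀ L : Set α, IsLowerSet L →
    posUnion (M.reorient B).circuits L = posUnion (M.reorient A).circuits L ∧
    posUnion (M.reorient B).cocircuits L = posUnion (M.reorient A).cocircuits L

variable {M} {A B : Finset α}

theorem SameParts.refl (A : Finset α) : M.SameParts A A := fun _ _ => ⟨rfl, rfl⟩

theorem SameParts.symm (h : M.SameParts A B) : M.SameParts B A := fun L hL =>
  ⟨(h L hL).1.symm, (h L hL).2.symm⟩

theorem SameParts.trans {C : Finset α} (h : M.SameParts A B) (h' : M.SameParts B C) :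
    M.SameParts A C := fun L hL =>
  ⟨(h' L hL).1.trans (h L hL).1, (h' L hL).2.trans (h L hL).2⟩

theorem sameParts_symmDiff_of_circuits {S : Finset α} {L : Set α} (hL : IsLowerSet L)
    (hS : (S : Set α) = posUnion (M.reorient A).circuits L) : M.SameParts A (symmDiff A S) :=
  fun _ hL' => (M.reorient A).dualPair.posUnion_flip (M.reorient (symmDiff A S)).dualPair
    (M.reorient A).support_subset (M.reorient (symmDiff A S)).support_subset
    (fun _ => M.mem_reorient_symmDiff_circuits) (fun _ => M.mem_reorient_symmDiff_cocircuits)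
    hL hS hL'

theorem sameParts_symmDiff_of_cocircuits {S : Finset α} {L : Set α} (hL : IsLowerSet L)
    (hS : (S : Set α) = posUnion (M.reorient A).cocircuits L) : M.SameParts A (symmDiff A S) :=
  fun _ hL' => ((M.reorient A).dualPair.symm.posUnion_flip
    (M.reorient (symmDiff A S)).dualPair.symm
    (fun _ => (M.reorient A).support_subset_of_mem_cocircuits)
    (fun _ => (M.reorient (symmDiff A S)).support_subset_of_mem_cocircuits)
    (fun _ => M.mem_reorient_symmDiff_cocircuits) (fun _ => M.mem_reorient_symmDiff_circuits)
    hL hS hL').symm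

theorem SameParts.activeElements_eq (h : M.SameParts A B) :
    (M.reorient B).activeElements = (M.reorient A).activeElements := by
  ext a
  rw [mem_activeElements_iff, mem_activeElements_iff, (h _ (isLowerSet_Iio a)).1]

theorem SameParts.dualActiveElements_eq (h : M.SameParts A B) :
    (M.reorient B).dualActiveElements = (M.reorient A).dualActiveElements := by
  ext a
  rw [mem_dualActiveElements_iff, mem_dualActiveElements_iff, (h _ (isLowerSet_Iio a)).2]

theorem SameParts.cyclicPart_eq (h : M.SameParts A B) (a : α) :
    (M.reorient B).cyclicPart a = (M.reorient A).cyclicPart a := by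
  rw [OrientedMatroid.cyclicPart_eq, OrientedMatroid.cyclicPart_eq, (h _ (isLowerSet_Iio a)).1,
    (h _ (isLowerSet_Iic a)).1]

theorem SameParts.acyclicPart_eq (h : M.SameParts A B) (a : α) :
    (M.reorient B).acyclicPart a = (M.reorient A).acyclicPart a := by
  rw [OrientedMatroid.acyclicPart_eq, OrientedMatroid.acyclicPart_eq,
    (h _ (isLowerSet_Iio a)).2, (h _ (isLowerSet_Iic a)).2]

theorem SameParts.part_eq (h : M.SameParts A B) (a : α) :
    (M.reorient B).part a = (M.reorient A).part a := by
  rw [part, part, h.cyclicPart_eq, h.acyclicPart_eq]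

omit [LinearOrder α] in
theorem exists_finset_coe_eq {S : Set α} {E : Finset α} (h : S ⊆ E) : ∃ T : Finset α, ↑T = S :=
  (E.finite_toSet.subset h).exists_finset_coe

theorem coe_symmDiff_eq_sdiff {S T : Finset α} (h : T ⊆ S) :
    ((symmDiff S T : Finset α) : Set α) = ↑S \ ↑T := by
  rw [Finset.coe_symmDiff, Set.symmDiff_def, Set.sdiff_eq_empty.2 (Finset.coe_subset.2 h),
    Set.union_empty]

/-- Flipping a difference of nested unions is flipping one and then the other. The second flip is
legitimate because the first preserves the unions. -/
theorem sameParts_symmDiff_cyclicPart {S : Finset α} {a : α}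
    (hS : (S : Set α) = (M.reorient A).cyclicPart a) : M.SameParts A (symmDiff A S) := by
  obtain ⟨S₁, h₁⟩ := exists_finset_coe_eq ((M.reorient A).posUnion_circuits_subset (Set.Iio a))
  obtain ⟨S₂, h₂⟩ := exists_finset_coe_eq ((M.reorient A).posUnion_circuits_subset (Set.Iic a))
  have hsub : S₂ ⊆ S₁ := by
    rw [← Finset.coe_subset, h₁, h₂]
    exact posUnion_anti _ fun z hz => (Set.mem_Iio.1 hz).le
  obtain rfl : S = symmDiff S₁ S₂ := by
    rw [← Finset.coe_inj, coe_symmDiff_eq_sdiff hsub, h₁, h₂, hS, cyclicPart_eq]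
  rw [← symmDiff_assoc]
  have h := sameParts_symmDiff_of_circuits (isLowerSet_Iio a) h₁
  exact h.trans (sameParts_symmDiff_of_circuits (isLowerSet_Iic a)
    (h₂.trans (h _ (isLowerSet_Iic a)).1.symm))

theorem sameParts_symmDiff_acyclicPart {S : Finset α} {a : α}
    (hS : (S : Set α) = (M.reorient A).acyclicPart a) : M.SameParts A (symmDiff A S) := by
  obtain ⟨S₁, h₁⟩ := exists_finset_coe_eq ((M.reorient A).posUnion_cocircuits_subset (Set.Iio a))
  obtain ⟨S₂, h₂⟩ := exists_finset_coe_eq ((M.reorient A).posUnion_cocircuits_subset (Set.Iic a))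
  have hsub : S₂ ⊆ S₁ := by
    rw [← Finset.coe_subset, h₁, h₂]
    exact posUnion_anti _ fun z hz => (Set.mem_Iio.1 hz).le
  obtain rfl : S = symmDiff S₁ S₂ := by
    rw [← Finset.coe_inj, coe_symmDiff_eq_sdiff hsub, h₁, h₂, hS, acyclicPart_eq]
  rw [← symmDiff_assoc]
  have h := sameParts_symmDiff_of_cocircuits (isLowerSet_Iio a) h₁
  exact h.trans (sameParts_symmDiff_of_cocircuits (isLowerSet_Iic a)
    (h₂.trans (h _ (isLowerSet_Iic a)).2.symm))

variable (M)

open Classical in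
/-- The union of the parts of the active partition of `-_A M` with minimum in `T`. -/
noncomputable def partUnion (A T : Finset α) : Finset α :=
  M.E.filter fun x => ∃ a ∈ T, x ∈ (M.reorient A).part a

theorem part_subset (a : α) : M.part a ⊆ M.E := by
  rw [part, cyclicPart_eq, acyclicPart_eq]
  exact Set.union_subset (Set.sdiff_subset.trans (M.posUnion_circuits_subset _))
    (Set.sdiff_subset.trans (M.posUnion_cocircuits_subset _))

theorem mem_partUnion {T : Finset α} {x : α} :
    x ∈ M.partUnion A T ↔ ∃ a ∈ T, x ∈ (M.reorient A).part a := by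
  classical
  rw [partUnion, Finset.mem_filter, and_iff_right_iff_imp]
  rintro ⟨a, -, hx⟩
  exact (M.reorient A).part_subset a hx

theorem partUnion_subset (A T : Finset α) : M.partUnion A T ⊆ M.E := by
  classical exact Finset.filter_subset _ _

theorem partUnion_symmDiff (T T' : Finset α) :
    M.partUnion A (symmDiff T T') = symmDiff (M.partUnion A T) (M.partUnion A T') := by
  ext x
  simp only [Finset.mem_symmDiff, mem_partUnion]
  constructor
  · rintro ⟨a, ⟨h1, h2⟩ | ⟨h1, h2⟩, hx⟩
    · refine Or.inl ⟨⟨a, h1, hx⟩, ?_⟩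
      rintro ⟨b, hb, hxb⟩
      exact h2 ((M.reorient A).eq_of_mem_part hx hxb ▸ hb)
    · refine Or.inr ⟨⟨a, h1, hx⟩, ?_⟩
      rintro ⟨b, hb, hxb⟩
      exact h2 ((M.reorient A).eq_of_mem_part hx hxb ▸ hb)
  · rintro (⟨⟨a, h1, hx⟩, h2⟩ | ⟨⟨a, h1, hx⟩, h2⟩)
    · exact ⟨a, Or.inl ⟨h1, fun h => h2 ⟨a, h, hx⟩⟩, hx⟩
    · exact ⟨a, Or.inr ⟨h1, fun h => h2 ⟨a, h, hx⟩⟩, hx⟩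

variable {M}

theorem SameParts.partUnion_eq (h : M.SameParts A B) (T : Finset α) :
    M.partUnion B T = M.partUnion A T := by
  ext x
  simp only [mem_partUnion, h.part_eq]

theorem sameParts_symmDiff_partUnion_singleton (A : Finset α) (a : α) :
    M.SameParts A (symmDiff A (M.partUnion A {a})) := by
  obtain ⟨S₁, h₁⟩ := exists_finset_coe_eq (Set.subset_union_left.trans
    ((M.reorient A).part_subset a))
  obtain ⟨S₂, h₂⟩ := exists_finset_coe_eq (Set.subset_union_right.trans
    ((M.reorient A).part_subset a))
  have hU : M.partUnion A {a} = symmDiff S₁ S₂ := by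
    have hd : Disjoint S₁ S₂ := by
      rw [← Finset.disjoint_coe, h₁, h₂, cyclicPart_eq, acyclicPart_eq]
      exact ((M.reorient A).dualPair.disjoint_posUnion _ _).mono Set.sdiff_subset Set.sdiff_subset
    rw [hd.symmDiff_eq_sup, Finset.sup_eq_union, ← Finset.coe_inj, Finset.coe_union, h₁, h₂]
    ext x
    simp [mem_partUnion, part]
  rw [hU, ← symmDiff_assoc]
  have h := sameParts_symmDiff_cyclicPart h₁
  exact h.trans (sameParts_symmDiff_acyclicPart (h₂.trans (h.acyclicPart_eq a).symm))

/-- Reorienting a union of parts of the active partition does not change the active partition. -/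
theorem sameParts_symmDiff_partUnion (A T : Finset α) :
    M.SameParts A (symmDiff A (M.partUnion A T)) := by
  induction T using Finset.induction_on with
  | empty =>
    have : M.partUnion A ∅ = ∅ := by
      ext
      simp [mem_partUnion]
    rw [this]
    have : symmDiff A ∅ = A := symmDiff_bot A
    rw [this]
    exact SameParts.refl A
  | insert a T ha ih =>
    rw [← symmDiff_singleton_of_notMem ha, partUnion_symmDiff, ← symmDiff_assoc,
      ← ih.partUnion_eq {a}]
    exact ih.trans (sameParts_symmDiff_partUnion_singleton _ a)

end Parts

end OrientedMatroid

namespace OrientedMatroid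

/-! ### Activity classes as Boolean cubes. -/

section Classes

variable {α : Type*} [LinearOrder α] (M : OrientedMatroid α)

/-- The active elements of `-_A M`, as a finite set. -/
noncomputable def activeFinset (A : Finset α) : Finset α :=
  minima (M.reorient A).circuits M.E (M.E : Set α)ᶜ

/-- The dual-active elements of `-_A M`, as a finite set. -/
noncomputable def dualActiveFinset (A : Finset α) : Finset α :=
  minima (M.reorient A).cocircuits M.E (M.E : Set α)ᶜ

theorem mem_minima_ground_iff {V : Set (α → SignType)}
    (hV : ∀ X ∈ V, Function.support X ⊆ M.E) {a : α} :
    a ∈ minima V M.E (M.E : Set α)ᶜ ↔ a ∈ posUnion V (Set.Iio a) := by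
  have h0 : ∀ X ∈ V, ∀ z ∉ M.E, X z = 0 := fun X hX z hz => by
    by_contra h
    exact hz (hV X hX h)
  rw [mem_minima]
  constructor
  · rintro ⟨-, X, hX, hXa, hXZ, hXF⟩
    refine ⟨X, hX, fun z => ?_, hXa, fun z hz => ?_⟩
    · by_cases h : z ∈ M.E
      exacts [(hXF z h).1, (h0 X hX z h).ge]
    · by_cases h : z ∈ M.E
      exacts [(hXF z h).2 hz, h0 X hX z h]
  · rintro ⟨X, hX, hX0, hXa, hXL⟩
    refine ⟨hV X hX (by rw [Function.mem_support, hXa]; decide), X, hX, hXa, h0 X hX,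
      fun z _ => ⟨hX0 z, fun h => hXL z h⟩⟩

theorem coe_activeFinset (A : Finset α) :
    (M.activeFinset A : Set α) = (M.reorient A).activeElements := by
  ext a
  rw [mem_activeElements_iff]
  exact M.mem_minima_ground_iff (M.reorient A).support_subset

theorem coe_dualActiveFinset (A : Finset α) :
    (M.dualActiveFinset A : Set α) = (M.reorient A).dualActiveElements := by
  ext a
  rw [mem_dualActiveElements_iff]
  exact M.mem_minima_ground_iff fun _ => (M.reorient A).support_subset_of_mem_cocircuits

theorem card_activeFinset (A : Finset α) : (M.activeFinset A).card = (M.reorient A).activity := by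
  rw [activity, ← coe_activeFinset, Set.ncard_coe_finset]

theorem card_dualActiveFinset (A : Finset α) :
    (M.dualActiveFinset A).card = (M.reorient A).dualActivity := by
  rw [dualActivity, ← coe_dualActiveFinset, Set.ncard_coe_finset]

theorem activeFixed_iff {A : Finset α} : M.ActiveFixed A ↔ Disjoint A (M.activeFinset A) := by
  rw [ActiveFixed, ← coe_activeFinset, ← Finset.coe_inter, Finset.coe_eq_empty,
    ← Finset.disjoint_iff_inter_eq_empty, disjoint_comm]

theorem dualActiveFixed_iff {A : Finset α} :
    M.DualActiveFixed A ↔ Disjoint A (M.dualActiveFinset A) := by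
  rw [DualActiveFixed, ← coe_dualActiveFinset, ← Finset.coe_inter, Finset.coe_eq_empty,
    ← Finset.disjoint_iff_inter_eq_empty, disjoint_comm]

theorem disjoint_activeFinset (A : Finset α) :
    Disjoint (M.activeFinset A) (M.dualActiveFinset A) := by
  rw [← Finset.disjoint_coe, coe_activeFinset, coe_dualActiveFinset, Set.disjoint_left]
  exact fun a h h' => ((M.reorient A).notMem_activeElements_or a).elim (· h) (· h')

theorem acyclic_iff {A : Finset α} : (M.reorient A).Acyclic ↔ M.activeFinset A = ∅ := by
  rw [← Finset.coe_eq_empty, coe_activeFinset, Set.eq_empty_iff_forall_notMem, Acyclic,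
    Set.eq_empty_iff_forall_notMem]
  constructor
  · rintro h a ⟨C, hC, -⟩
    exact h C hC
  · rintro h C ⟨X, hX, hX0, rfl⟩
    have hne : (Function.support X).Nonempty := by
      rw [Function.support_nonempty_iff]
      rintro rfl
      exact (M.reorient A).zero_notMem hX
    obtain ⟨m, hm⟩ := (M.E.finite_toSet.subset
      ((M.reorient A).support_subset X hX)).exists_minimal hne
    exact h m ⟨_, ⟨X, hX, hX0, rfl⟩, hm.1, fun z hz => (le_total m z).elim id (hm.2 hz)⟩

/-- The colouring lemma with nothing coloured puts each element in a positive circuit or a positive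
cocircuit, and not in both by orthogonality. -/
theorem totallyCyclic_iff {A : Finset α} :
    (M.reorient A).TotallyCyclic ↔ M.dualActiveFinset A = ∅ := by
  rw [← Finset.coe_eq_empty, coe_dualActiveFinset, Set.eq_empty_iff_forall_notMem]
  have hpos : ∀ e, (∃ C ∈ (M.reorient A).posCircuits, e ∈ C) ↔
      e ∈ posUnion (M.reorient A).circuits ∅ := by
    intro e
    constructor
    · rintro ⟨_, ⟨X, hX, hX0, rfl⟩, he⟩
      exact mem_posUnion_of_ne_zero hX hX0 (by simp) he
    · rintro ⟨X, hX, hX0, hXe, -⟩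
      exact ⟨_, ⟨X, hX, hX0, rfl⟩, by rw [Function.mem_support, hXe]; decide⟩
  constructor
  · intro h a ha
    rw [mem_dualActiveElements_iff] at ha
    have haE := (M.reorient A).posUnion_cocircuits_subset _ ha
    exact Set.disjoint_left.1 ((M.reorient A).dualPair.disjoint_posUnion _ _)
      ((hpos a).1 (h a haE)) ha
  · intro h e he
    rw [hpos]
    rcases (M.reorient A).colouring e he ∅ ∅ (by simp) (by simp) (by simp) with
      ⟨X, hX, hXe, -, hX0⟩ | ⟨Y, hY, hYe, -, hY0⟩
    · exact ⟨X, hX, fun z => hX0 z (by simp), hXe, by simp⟩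
    · obtain ⟨m, hm⟩ := (M.E.finite_toSet.subset
        ((M.reorient A).support_subset_of_mem_cocircuits hY)).exists_minimal hY.1.nonempty
      exact absurd ⟨_, ⟨Y, hY, fun z => hY0 z (by simp), rfl⟩, hm.1,
        fun z hz => (le_total m z).elim id (hm.2 hz)⟩ (h m)

/-- The minima of the parts of the active partition of `-_A M`. -/
noncomputable def partMinima (A : Finset α) : Finset α := M.activeFinset A ∪ M.dualActiveFinset A

variable {M} {A B : Finset α}

theorem SameParts.activeFinset_eq (h : M.SameParts A B) :
    M.activeFinset B = M.activeFinset A := by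
  rw [← Finset.coe_inj, coe_activeFinset, coe_activeFinset, h.activeElements_eq]

theorem SameParts.dualActiveFinset_eq (h : M.SameParts A B) :
    M.dualActiveFinset B = M.dualActiveFinset A := by
  rw [← Finset.coe_inj, coe_dualActiveFinset, coe_dualActiveFinset, h.dualActiveElements_eq]

theorem SameParts.partMinima_eq (h : M.SameParts A B) : M.partMinima B = M.partMinima A := by
  rw [partMinima, partMinima, h.activeFinset_eq, h.dualActiveFinset_eq]

theorem mem_activityClass_iff :
    B ∈ M.activityClass A ↔ ∃ T ⊆ M.partMinima A, B = symmDiff A (M.partUnion A T) := by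
  have hQ : ((M.reorient A).activeElements ∪ (M.reorient A).dualActiveElements) =
      (M.partMinima A : Set α) := by
    rw [partMinima, Finset.coe_union, coe_activeFinset, coe_dualActiveFinset]
  rw [activityClass, Set.mem_ofPred_eq, activePartition_eq, hQ]
  have hU : ∀ T : Finset α, ⋃₀ ((M.reorient A).part '' T) = (M.partUnion A T : Set α) := by
    intro T
    ext x
    simp [mem_partUnion]
  constructor
  · rintro ⟨P, hP, hB⟩
    obtain ⟨T, hT, rfl⟩ := Set.subset_image_iff.1 hP
    obtain ⟨T, rfl⟩ := exists_finset_coe_eq hT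
    refine ⟨T, Finset.coe_subset.1 hT, ?_⟩
    rw [← Finset.coe_inj, hB, hU, Finset.coe_symmDiff]
  · rintro ⟨T, hT, rfl⟩
    exact ⟨_, Set.image_mono (Finset.coe_subset.2 hT), by rw [hU, Finset.coe_symmDiff]⟩

theorem sameParts_of_mem_activityClass (h : B ∈ M.activityClass A) : M.SameParts A B := by
  obtain ⟨T, -, rfl⟩ := mem_activityClass_iff.1 h
  exact sameParts_symmDiff_partUnion A T

theorem self_mem_activityClass (A : Finset α) : A ∈ M.activityClass A := by
  refine mem_activityClass_iff.2 ⟨∅, by simp, ?_⟩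
  have : M.partUnion A ∅ = ⊥ := by
    ext
    simp [mem_partUnion]
  rw [this, symmDiff_bot]

theorem subset_of_mem_activityClass (hA : A ⊆ M.E) (h : B ∈ M.activityClass A) : B ⊆ M.E := by
  obtain ⟨T, -, rfl⟩ := mem_activityClass_iff.1 h
  intro x hx
  rcases Finset.mem_symmDiff.1 hx with h | h
  exacts [hA h.1, M.partUnion_subset _ _ h.1]

theorem mem_activityClass_symm (h : B ∈ M.activityClass A) : A ∈ M.activityClass B := by
  have hs := sameParts_of_mem_activityClass h
  obtain ⟨T, hT, rfl⟩ := mem_activityClass_iff.1 h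
  -- The same union of parts leads back, since the partition has not changed.
  exact mem_activityClass_iff.2 ⟨T, by rwa [hs.partMinima_eq], by
    rw [hs.partUnion_eq, symmDiff_symmDiff_cancel_right]⟩

theorem mem_activityClass_trans {C : Finset α} (h : B ∈ M.activityClass A)
    (h' : C ∈ M.activityClass B) : C ∈ M.activityClass A := by
  have hs := sameParts_of_mem_activityClass h
  obtain ⟨T', hT', rfl⟩ := mem_activityClass_iff.1 h'
  rw [hs.partMinima_eq] at hT'
  rw [hs.partUnion_eq]
  obtain ⟨T, hT, rfl⟩ := mem_activityClass_iff.1 h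
  refine mem_activityClass_iff.2 ⟨symmDiff T T', fun x hx => ?_, by
    rw [partUnion_symmDiff, symmDiff_assoc]⟩
  rcases Finset.mem_symmDiff.1 hx with h | h
  exacts [hT h.1, hT' h.1]

theorem activityClass_eq_of_mem (h : B ∈ M.activityClass A) :
    M.activityClass B = M.activityClass A :=
  Set.ext fun _ => ⟨mem_activityClass_trans h, mem_activityClass_trans (mem_activityClass_symm h)⟩

theorem mem_partUnion_iff_of_mem_partMinima {T : Finset α} {a : α} (ha : a ∈ M.partMinima A) :
    a ∈ M.partUnion A T ↔ a ∈ T := by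
  have ha' : a ∈ (M.reorient A).part a := by
    apply mem_part_self
    rwa [← coe_activeFinset, ← coe_dualActiveFinset, ← Finset.coe_union]
  rw [mem_partUnion]
  constructor
  · rintro ⟨b, hb, h⟩
    rwa [(M.reorient A).eq_of_mem_part ha' h]
  · exact fun h => ⟨a, h, ha'⟩

theorem symmDiff_partUnion_inter {T : Finset α} (hT : T ⊆ M.partMinima A) :
    symmDiff A (M.partUnion A T) ∩ M.partMinima A = symmDiff (A ∩ M.partMinima A) T := by
  ext x
  simp only [Finset.mem_inter, Finset.mem_symmDiff]
  by_cases hx : x ∈ M.partMinima A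
  · simp [hx, mem_partUnion_iff_of_mem_partMinima hx]
  · have : x ∉ T := fun h => hx (hT h)
    simp [hx, this]

/-- A member of an activity class is determined by which minima of parts it contains, and these
can be prescribed. -/
theorem bijOn_activityClass (A : Finset α) :
    Set.BijOn (· ∩ M.partMinima A) (M.activityClass A) (M.partMinima A).powerset := by
  refine ⟨fun B _ => by simp, ?_, ?_⟩
  · intro B hB B' hB' h
    obtain ⟨T, hT, rfl⟩ := mem_activityClass_iff.1 hB
    obtain ⟨T', hT', rfl⟩ := mem_activityClass_iff.1 hB'
    simp only [symmDiff_partUnion_inter hT, symmDiff_partUnion_inter hT'] at h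
    rw [symmDiff_right_injective _ h]
  · intro T hT
    have hT' : T ⊆ M.partMinima A := by simpa using hT
    have hsub : symmDiff (A ∩ M.partMinima A) T ⊆ M.partMinima A := by
      intro x hx
      rcases Finset.mem_symmDiff.1 hx with h | h
      exacts [(Finset.mem_inter.1 h.1).2, hT' h.1]
    refine ⟨_, mem_activityClass_iff.2 ⟨_, hsub, rfl⟩, ?_⟩
    simp only [symmDiff_partUnion_inter hsub, symmDiff_symmDiff_cancel_left]

theorem activeFixed_iff_inter (h : B ∈ M.activityClass A) :
    M.ActiveFixed B ↔ Disjoint (B ∩ M.partMinima A) (M.activeFinset A) := by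
  rw [activeFixed_iff, (sameParts_of_mem_activityClass h).activeFinset_eq,
    Finset.disjoint_iff_inter_eq_empty, Finset.disjoint_iff_inter_eq_empty, Finset.inter_assoc,
    partMinima, Finset.union_inter_cancel_left]

theorem dualActiveFixed_iff_inter (h : B ∈ M.activityClass A) :
    M.DualActiveFixed B ↔ Disjoint (B ∩ M.partMinima A) (M.dualActiveFinset A) := by
  rw [dualActiveFixed_iff, (sameParts_of_mem_activityClass h).dualActiveFinset_eq,
    Finset.disjoint_iff_inter_eq_empty, Finset.disjoint_iff_inter_eq_empty, Finset.inter_assoc,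
    partMinima, Finset.union_inter_cancel_right]

/-- Under `bijOn_activityClass`, a fixedness condition forbids some minima; `Q` is the set of those
still free. -/
theorem ncard_filter_activityClass {p : Finset α → Prop} {q : Finset α → Prop} {Q : Finset α}
    (hpq : ∀ B ∈ M.activityClass A, p B ↔ q (B ∩ M.partMinima A))
    (hq : ∀ T, (T ⊆ M.partMinima A ∧ q T) ↔ T ⊆ Q) :
    {B ∈ M.activityClass A | p B}.ncard = 2 ^ Q.card := by
  have hbij := bijOn_activityClass (M := M) A
  rw [← Finset.card_powerset, ← Set.ncard_coe_finset,
    ← Set.InjOn.ncard_image (hbij.injOn.mono (Set.sep_subset _ p))]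
  congr 1
  ext T
  simp only [Finset.coe_powerset, Set.mem_preimage, Set.mem_powerset_iff, Finset.coe_subset]
  rw [← hq]
  constructor
  · rintro ⟨B, ⟨hB, hp⟩, rfl⟩
    exact ⟨Finset.inter_subset_right, (hpq B hB).1 hp⟩
  · rintro ⟨hT, hqT⟩
    obtain ⟨B, hB, rfl⟩ := hbij.surjOn (by simpa using hT)
    exact ⟨B, ⟨hB, (hpq B hB).2 hqT⟩, rfl⟩

theorem ncard_activeFixed_activityClass (A : Finset α) :
    {B ∈ M.activityClass A | M.ActiveFixed B}.ncard = 2 ^ (M.reorient A).dualActivity := by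
  rw [← card_dualActiveFinset]
  refine ncard_filter_activityClass (q := (Disjoint · (M.activeFinset A)))
    (fun B hB => activeFixed_iff_inter hB) fun T => ?_
  rw [partMinima, ← Finset.union_comm, and_comm, disjoint_comm]
  exact ⟨fun h => fun x hx =>
    (Finset.mem_union.1 (h.2 hx)).resolve_right (Finset.disjoint_right.1 h.1 hx), fun h =>
    ⟨(M.disjoint_activeFinset A).mono_right h, h.trans Finset.subset_union_left⟩⟩

theorem ncard_dualActiveFixed_activityClass (A : Finset α) :
    {B ∈ M.activityClass A | M.DualActiveFixed B}.ncard = 2 ^ (M.reorient A).activity := by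
  rw [← card_activeFinset]
  refine ncard_filter_activityClass (q := (Disjoint · (M.dualActiveFinset A)))
    (fun B hB => dualActiveFixed_iff_inter hB) fun T => ?_
  rw [partMinima, and_comm, disjoint_comm]
  exact ⟨fun h => fun x hx =>
    (Finset.mem_union.1 (h.2 hx)).resolve_right (Finset.disjoint_right.1 h.1 hx), fun h =>
    ⟨(M.disjoint_activeFinset A).symm.mono_right h, h.trans Finset.subset_union_left⟩⟩

/-- Being fixed in both senses means containing no minimum of a part: the empty vertex of the cube.
-/
theorem existsUnique_fixed (A : Finset α) :
    ∃! B, B ∈ M.activityClass A ∧ M.ActiveFixed B ∧ M.DualActiveFixed B := by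
  have hbij := bijOn_activityClass (M := M) A
  have hiff : ∀ B ∈ M.activityClass A,
      (M.ActiveFixed B ∧ M.DualActiveFixed B ↔ B ∩ M.partMinima A = ∅) := by
    intro B hB
    rw [activeFixed_iff_inter hB, dualActiveFixed_iff_inter hB, ← Finset.disjoint_union_right,
      ← partMinima, Finset.disjoint_iff_inter_eq_empty, Finset.inter_assoc, Finset.inter_self]
  obtain ⟨B, hB, hB0⟩ := hbij.surjOn (show ∅ ∈ _ by simp)
  refine ⟨B, ⟨hB, (hiff B hB).2 hB0⟩, fun B' ⟨hB', h⟩ => hbij.injOn hB' hB ?_⟩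
  exact ((hiff B' hB').1 h).trans hB0.symm

/-! ### Enumeration through fixed representatives. -/

variable (M)

open Classical in
/-- The reorientations that are both active-fixed and dual-active-fixed. -/
noncomputable def fixedReorientations : Finset (Finset α) :=
  M.E.powerset.filter fun A => M.ActiveFixed A ∧ M.DualActiveFixed A

variable {M}

theorem mem_fixedReorientations :
    A ∈ M.fixedReorientations ↔ A ⊆ M.E ∧ M.ActiveFixed A ∧ M.DualActiveFixed A := by
  classical simp [fixedReorientations]

variable (M)

theorem tutte_eq_sum : M.tutte = ∑ A ∈ M.fixedReorientations,
    MvPolynomial.X 0 ^ (M.reorient A).dualActivity * MvPolynomial.X 1 ^ (M.reorient A).activity := by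
  classical
  -- Nothing is contracted, and the elements of the ambient type outside the ground set count as
  -- deleted.
  rw [← minorTutte_ground, ← M.sum_fixedWeight_eq_minorTutte _ _ M.E subset_rfl ∅ (M.E : Set α)ᶜ
    (by simp) (by simp) (by simp) (fun z => by simpa using em _), fixedReorientations,
    Finset.sum_filter]
  refine Finset.sum_congr rfl fun A _ => ?_
  have h : minima (M.reorient A).cocircuits M.E ∅ = M.dualActiveFinset A := by
    refine minima_congr fun a _ => ⟨fun ⟨X, hX, h1, _, h2⟩ => ⟨X, hX, h1, fun z hz => ?_, h2⟩,
      fun ⟨X, hX, h1, _, h2⟩ => ⟨X, hX, h1, by simp, h2⟩⟩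
    by_contra h
    exact hz ((M.reorient A).support_subset_of_mem_cocircuits hX h)
  rw [h, fixedWeight, ← activeFinset, card_activeFinset, card_dualActiveFinset, activeFixed_iff,
    dualActiveFixed_iff]
  congr

theorem tutteEval_eq_sum (u v : ℤ) : M.tutteEval u v = ∑ A ∈ M.fixedReorientations,
    u ^ (M.reorient A).dualActivity * v ^ (M.reorient A).activity := by
  rw [tutteEval, tutte_eq_sum]
  simp

theorem ncard_fixed_and_eq (p : Finset α → Prop) [DecidablePred p] :
    {A : Finset α | A ⊆ M.E ∧ M.ActiveFixed A ∧ M.DualActiveFixed A ∧ p A}.ncard =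
      (M.fixedReorientations.filter p).card := by
  rw [← Set.ncard_coe_finset]
  congr 1
  ext A
  simp [mem_fixedReorientations, and_assoc]

theorem tutteCoeff_eq_card (i j : ℕ) : M.tutteCoeff j i =
    (M.fixedReorientations.filter fun A =>
      (M.reorient A).activity = i ∧ (M.reorient A).dualActivity = j).card := by
  have hmon : ∀ a b : ℕ, (MvPolynomial.X 0 ^ a * MvPolynomial.X 1 ^ b : MvPolynomial (Fin 2) ℤ) =
      MvPolynomial.monomial (Finsupp.single 0 a + Finsupp.single 1 b) 1 := by
    intro a b
    rw [MvPolynomial.X_pow_eq_monomial, MvPolynomial.X_pow_eq_monomial, MvPolynomial.monomial_mul,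
      one_mul]
  have hinj : ∀ a b c d : ℕ, (Finsupp.single 0 a + Finsupp.single 1 b : Fin 2 →₀ ℕ) =
      Finsupp.single 0 c + Finsupp.single 1 d ↔ (b = d ∧ a = c) := by
    intro a b c d
    constructor
    · intro h
      exact ⟨by simpa using DFunLike.congr_fun h 1, by simpa using DFunLike.congr_fun h 0⟩
    · rintro ⟨rfl, rfl⟩
      rfl
  rw [tutteCoeff, tutte_eq_sum, MvPolynomial.coeff_sum, Finset.card_filter, Nat.cast_sum]
  refine Finset.sum_congr rfl fun A _ => ?_
  rw [hmon, MvPolynomial.coeff_monomial, Nat.cast_ite, Nat.cast_one, Nat.cast_zero]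
  exact if_congr (hinj _ _ _ _) rfl rfl

/-- Classes correspond to their fixed members, and a property depending only on the active partition
can be tested there. -/
theorem ncard_activityClasses_forall (p : Finset α → Prop) [DecidablePred p]
    (hp : ∀ A B, M.SameParts A B → (p B ↔ p A)) :
    {K ∈ M.activityClasses | ∀ A ∈ K, p A}.ncard = (M.fixedReorientations.filter p).card := by
  rw [← Set.ncard_coe_finset, ← Set.InjOn.ncard_image (f := M.activityClass)]
  · congr 1
    ext K
    constructor
    · rintro ⟨⟨A, hA, rfl⟩, h⟩
      obtain ⟨B, ⟨hB, hB'⟩, -⟩ := existsUnique_fixed (M := M) A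
      refine ⟨B, ?_, activityClass_eq_of_mem hB⟩
      rw [Finset.mem_coe, Finset.mem_filter, mem_fixedReorientations]
      exact ⟨⟨subset_of_mem_activityClass hA hB, hB'⟩, h B hB⟩
    · rintro ⟨A, hA, rfl⟩
      rw [Finset.mem_coe, Finset.mem_filter, mem_fixedReorientations] at hA
      exact ⟨⟨A, hA.1.1, rfl⟩, fun B hB => (hp A B (sameParts_of_mem_activityClass hB)).2 hA.2⟩
  · intro A hA B hB h
    rw [Finset.mem_coe, Finset.mem_filter, mem_fixedReorientations] at hA hB
    exact (existsUnique_fixed (M := M) A).unique ⟨self_mem_activityClass A, hA.1.2⟩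
      ⟨h ▸ self_mem_activityClass B, hB.1.2⟩

/-- Fibre the reorientations over the fixed member of their class. -/
theorem ncard_eq_sum_ncard_activityClass (p : Finset α → Prop) :
    {A : Finset α | A ⊆ M.E ∧ p A}.ncard =
      ∑ A ∈ M.fixedReorientations, {B ∈ M.activityClass A | p B}.ncard := by
  classical
  choose r hr _ using fun A => existsUnique_fixed (M := M) A
  have hset : {A : Finset α | A ⊆ M.E ∧ p A} = ↑(M.E.powerset.filter p) := by
    ext
    simp
  rw [hset, Set.ncard_coe_finset, Finset.card_eq_sum_card_fiberwise (f := r)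
    (t := M.fixedReorientations)]
  · refine Finset.sum_congr rfl fun A hA => ?_
    rw [← Set.ncard_coe_finset]
    congr 1
    rw [mem_fixedReorientations] at hA
    ext B
    simp only [Finset.coe_filter, Finset.mem_filter, Finset.mem_powerset, Set.mem_ofPred_eq]
    constructor
    · rintro ⟨⟨-, hp⟩, rfl⟩
      exact ⟨mem_activityClass_symm (hr B).1, hp⟩
    · rintro ⟨hB, hp⟩
      exact ⟨⟨subset_of_mem_activityClass hA.1 hB, hp⟩,
        (existsUnique_fixed B).unique (hr B) ⟨mem_activityClass_symm hB, hA.2⟩⟩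
  · intro A hA
    rw [Finset.mem_coe, Finset.mem_filter, Finset.mem_powerset] at hA
    exact Finset.mem_coe.2
      (mem_fixedReorientations.2 ⟨subset_of_mem_activityClass hA.1 (hr A).1, (hr A).2⟩)

variable {M}

theorem acyclic_iff_activity : (M.reorient A).Acyclic ↔ (M.reorient A).activity = 0 := by
  rw [acyclic_iff, ← card_activeFinset, Finset.card_eq_zero]

theorem totallyCyclic_iff_dualActivity :
    (M.reorient A).TotallyCyclic ↔ (M.reorient A).dualActivity = 0 := by
  rw [totallyCyclic_iff, ← card_dualActiveFinset, Finset.card_eq_zero]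

theorem Acyclic.activeFixed (h : (M.reorient A).Acyclic) : M.ActiveFixed A := by
  rw [activeFixed_iff, M.acyclic_iff.1 h]
  exact Finset.disjoint_empty_right _

theorem TotallyCyclic.dualActiveFixed (h : (M.reorient A).TotallyCyclic) :
    M.DualActiveFixed A := by
  rw [dualActiveFixed_iff, M.totallyCyclic_iff.1 h]
  exact Finset.disjoint_empty_right _

theorem SameParts.activity_eq (h : M.SameParts A B) :
    (M.reorient B).activity = (M.reorient A).activity := by
  rw [← card_activeFinset, ← card_activeFinset, h.activeFinset_eq]

theorem SameParts.dualActivity_eq (h : M.SameParts A B) :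
    (M.reorient B).dualActivity = (M.reorient A).dualActivity := by
  rw [← card_dualActiveFinset, ← card_dualActiveFinset, h.dualActiveFinset_eq]

theorem card_filter_acyclic [DecidablePred fun A => (M.reorient A).Acyclic] :
    ((M.fixedReorientations.filter fun A => (M.reorient A).Acyclic).card : ℤ) =
      M.tutteEval 1 0 := by
  rw [tutteEval_eq_sum, Finset.card_filter, Nat.cast_sum]
  refine Finset.sum_congr rfl fun A _ => ?_
  -- At y = 0, the factor 0^(activity) is the indicator of activity zero, that is, of acyclicity.
  rw [one_pow, one_mul, zero_pow_eq, Nat.cast_ite, Nat.cast_one, Nat.cast_zero]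
  exact if_congr acyclic_iff_activity rfl rfl

theorem card_filter_totallyCyclic [DecidablePred fun A => (M.reorient A).TotallyCyclic] :
    ((M.fixedReorientations.filter fun A => (M.reorient A).TotallyCyclic).card : ℤ) =
      M.tutteEval 0 1 := by
  rw [tutteEval_eq_sum, Finset.card_filter, Nat.cast_sum]
  refine Finset.sum_congr rfl fun A _ => ?_
  rw [one_pow, mul_one, zero_pow_eq, Nat.cast_ite, Nat.cast_one, Nat.cast_zero]
  exact if_congr totallyCyclic_iff_dualActivity rfl rfl

theorem card_fixedReorientations : (M.fixedReorientations.card : ℤ) = M.tutteEval 1 1 := by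
  simp [tutteEval_eq_sum]

end Classes

end OrientedMatroid

/-! ### The enumerations. -/

theorem corollary4p10 {α : Type*} [LinearOrder α] (M : OrientedMatroid α) :
    -- the number of activity classes with activity `i` and dual activity `j`
    (∀ i j : ℕ, ({K ∈ M.activityClasses | M.ClassHasActivities K i j}.ncard : ℤ)
      = M.tutteCoeff j i) ∧
    -- the canonical representative of each class, and the number of such representatives
    (∀ K ∈ M.activityClasses, ∃! A, A ∈ K ∧ M.ActiveFixed A ∧ M.DualActiveFixed A) ∧
    (∀ i j : ℕ, ({A : Finset α | A ⊆ M.E ∧ M.ActiveFixed A ∧ M.DualActiveFixed A ∧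
      (M.reorient A).activity = i ∧ (M.reorient A).dualActivity = j}.ncard : ℤ)
      = M.tutteCoeff j i) ∧
    -- active-fixed and dual-active-fixed reorientations in a class
    (∀ i j : ℕ, ∀ K ∈ M.activityClasses, M.ClassHasActivities K i j →
      {A ∈ K | M.ActiveFixed A}.ncard = 2 ^ j ∧ {A ∈ K | M.DualActiveFixed A}.ncard = 2 ^ i) ∧
    -- `t(M;1,1)`
    (({A : Finset α | A ⊆ M.E ∧ M.ActiveFixed A ∧ M.DualActiveFixed A}.ncard : ℤ)
        = M.tutteEval 1 1 ∧
      (M.activityClasses.ncard : ℤ) = M.tutteEval 1 1) ∧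
    -- `t(M;1,0)`
    (({A : Finset α | A ⊆ M.E ∧ (M.reorient A).Acyclic ∧ M.DualActiveFixed A}.ncard : ℤ)
        = M.tutteEval 1 0 ∧
      ({K ∈ M.activityClasses | ∀ A ∈ K, (M.reorient A).Acyclic}.ncard : ℤ)
        = M.tutteEval 1 0 ∧
      (∀ K ∈ M.activityClasses, (∀ A ∈ K, (M.reorient A).Acyclic) →
        ∃! A, A ∈ K ∧ M.DualActiveFixed A)) ∧
    -- `t(M;0,1)`
    (({A : Finset α | A ⊆ M.E ∧ M.ActiveFixed A ∧ (M.reorient A).TotallyCyclic}.ncard : ℤ)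
        = M.tutteEval 0 1 ∧
      ({K ∈ M.activityClasses | ∀ A ∈ K, (M.reorient A).TotallyCyclic}.ncard : ℤ)
        = M.tutteEval 0 1 ∧
      (∀ K ∈ M.activityClasses, (∀ A ∈ K, (M.reorient A).TotallyCyclic) →
        ∃! A, A ∈ K ∧ M.ActiveFixed A)) ∧
    -- `t(M;2,1)` and `t(M;1,2)`
    ({A : Finset α | A ⊆ M.E ∧ M.ActiveFixed A}.ncard : ℤ) = M.tutteEval 2 1 ∧
    ({A : Finset α | A ⊆ M.E ∧ M.DualActiveFixed A}.ncard : ℤ) = M.tutteEval 1 2 := by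
  classical
  refine ⟨fun i j => ?_, ?_, fun i j => ?_, ?_, ⟨?_, ?_⟩, ⟨?_, ?_, ?_⟩, ⟨?_, ?_, ?_⟩, ?_, ?_⟩
  · rw [M.tutteCoeff_eq_card, ← M.ncard_activityClasses_forall _ fun A B h => by
      rw [h.activity_eq, h.dualActivity_eq]]
    rfl
  · rintro K ⟨A, -, rfl⟩
    exact OrientedMatroid.existsUnique_fixed A
  · rw [M.tutteCoeff_eq_card, ← M.ncard_fixed_and_eq]
  · rintro i j K ⟨A, -, rfl⟩ h
    obtain ⟨rfl, rfl⟩ := h A (OrientedMatroid.self_mem_activityClass A)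
    exact ⟨OrientedMatroid.ncard_activeFixed_activityClass A,
      OrientedMatroid.ncard_dualActiveFixed_activityClass A⟩
  · rw [← OrientedMatroid.card_fixedReorientations]
    simpa using M.ncard_fixed_and_eq fun _ => True
  · rw [← OrientedMatroid.card_fixedReorientations]
    simpa using M.ncard_activityClasses_forall (fun _ => True) (by simp)
  · rw [← OrientedMatroid.card_filter_acyclic, ← M.ncard_fixed_and_eq]
    congr 2
    ext A
    exact ⟨fun h => ⟨h.1, OrientedMatroid.Acyclic.activeFixed h.2.1, h.2.2, h.2.1⟩,
      fun h => ⟨h.1, h.2.2.2, h.2.2.1⟩⟩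
  · rw [← OrientedMatroid.card_filter_acyclic, M.ncard_activityClasses_forall _ fun A B h => by
      rw [OrientedMatroid.acyclic_iff, OrientedMatroid.acyclic_iff, h.activeFinset_eq]]
  · rintro K ⟨A, -, rfl⟩ h
    obtain ⟨B, ⟨hB, -, hB'⟩, huniq⟩ := OrientedMatroid.existsUnique_fixed (M := M) A
    exact ⟨B, ⟨hB, hB'⟩, fun C ⟨hC, hC'⟩ =>
      huniq C ⟨hC, OrientedMatroid.Acyclic.activeFixed (h C hC), hC'⟩⟩
  · rw [← OrientedMatroid.card_filter_totallyCyclic, ← M.ncard_fixed_and_eq]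
    congr 2
    ext A
    exact ⟨fun h => ⟨h.1, h.2.1, OrientedMatroid.TotallyCyclic.dualActiveFixed h.2.2, h.2.2⟩,
      fun h => ⟨h.1, h.2.1, h.2.2.2⟩⟩
  · rw [← OrientedMatroid.card_filter_totallyCyclic,
      M.ncard_activityClasses_forall _ fun A B h => by
        rw [OrientedMatroid.totallyCyclic_iff, OrientedMatroid.totallyCyclic_iff,
          h.dualActiveFinset_eq]]
  · rintro K ⟨A, -, rfl⟩ h
    obtain ⟨B, ⟨hB, hB', -⟩, huniq⟩ := OrientedMatroid.existsUnique_fixed (M := M) A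
    exact ⟨B, ⟨hB, hB'⟩, fun C ⟨hC, hC'⟩ =>
      huniq C ⟨hC, hC', OrientedMatroid.TotallyCyclic.dualActiveFixed (h C hC)⟩⟩
  -- Each class contributes 2^(dual activity), the value at (2, 1) of the monomial of its fixed
  -- member.
  · rw [M.ncard_eq_sum_ncard_activityClass, M.tutteEval_eq_sum, Nat.cast_sum]
    exact Finset.sum_congr rfl fun A _ => by
      simp [OrientedMatroid.ncard_activeFixed_activityClass]
  · rw [M.ncard_eq_sum_ncard_activityClass, M.tutteEval_eq_sum, Nat.cast_sum]
    exact Finset.sum_congr rfl fun A _ => by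
      simp [OrientedMatroid.ncard_dualActiveFixed_activityClass]
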